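/- Throughout, $\|\cdot\|$ is the Euclidean norm. Let $\lambda>0$, $H\ge 2\lambda$, $R\ge 0$, $\sigma\ge 0$, $\epsilon>0$. **Objectives.** Given $x_0\in\mathbb R^d$, let $\mathcal F[H,\lambda;R]$ be the class of differentiable $F:\mathbb R^d\to\mathbb R$ with $\frac{\lambda}{2}\|y-x\|^2\le F(y)-F(x)-\langle\nabla F(x),y-x\rangle\le\frac H2\|y-x\|^2$ for all $x,y$, that have a minimizer $x^*$ with $\|x_0-x^*\|\le R$. **Oracle.** A stochastic first-order oracle for $F$ with variance bound $\sigma^2$ is given by a probability distribution $\mathcal D$ on a space $\mathcal Z$ and a function $f:\mathbb R^d\times\mathcal Z\to\mathbb R$ such that, for every $x$, $f(\cdot;z)$ is differentiable at $x$ for $\mathcal D$-almost every $z$, and $\mathbb E_z f(x;z)=F(x)$, $\mathbb E_z\nabla f(x;z)=\nabla F(x)$, $\mathbb E_z\|\nabla f(x;z)-\nabla F(x)\|^2\le\sigma^2$ (the condition on $\mathbb E_z\nabla f$ is automatic if every $f(\cdot;z)$ is differentiable everywhere). Queried at $x$, it draws an independent $z\sim\mathcal D$ and returns $(f(x;z),\nabla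 f(x;z))$. **AC-SA** with smoothness $H'$, strong convexity $\lambda'$, $n$ accesses and initial point $x_0$: set $x_0^{ag}=x_0$; for $t=1,\dots,n$ put $\alpha_t=\frac2{t+1}$, $\gamma_t=\frac{4H'}{t(t+1)}$, $$x_t^{md}=\tfrac{(1-\alpha_t)(\lambda'+\gamma_t)}{\gamma_t+(1-\alpha_t^2)\lambda'}x_{t-1}^{ag}+\tfrac{\alpha_t((1-\alpha_t)\lambda'+\gamma_t)}{\gamma_t+(1-\alpha_t^2)\lambda'}x_{t-1},$$ let $g_t$ be the gradient returned by the oracle at $x_t^{md}$, and put $$x_t=\tfrac{\alpha_t\lambda'}{\lambda'+\gamma_t}x_t^{md}+\tfrac{(1-\alpha_t)\lambda'+\gamma_t}{\lambda'+\gamma_t}x_{t-1}-\tfrac{\alpha_t}{\lambda'+\gamma_t}g_t,\qquad x_t^{ag}=\alpha_tx_t+(1-\alpha_t)x_{t-1}^{ag};$$ return $x_n^{ag}$. **AC-SA²** with $n$ accesses runs AC-SA with $\lfloor n/2\rfloor$ accesses, and then AC-SA again with $\lfloor n/2\rfloor$ accesses from the point obtained. **Recursive regularization** (Algorithm 1)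 with $m$ allotted accesses: let $T=\lfloor\log_2(H/\lambda)\rfloor$ and $\hat x_0=x_0$. For $t=1,\dots,T$ let $\hat x_t$ be the output of AC-SA² with $\lfloor m/T\rfloor$ accesses, started at $\hat x_{t-1}$, on $$F^{(t-1)}(x)=F(x)+\lambda\sum_{k=1}^{t-1}2^{k-1}\|x-\hat x_k\|^2,$$ with smoothness $H+\lambda\sum_{k=1}^{t-1}2^k$ and strong convexity $\lambda+\lambda\sum_{k=1}^{t-1}2^k$, where the oracle for $F^{(t-1)}$ adds the value and gradient of the regularizer to the answers of the oracle for $F$. Return $\hat x=\hat x_T$. **Theorem.** There is an absolute constant $C>0$ such that for all $\lambda>0$, $H\ge2\lambda$, $R\ge0$, $\sigma\ge0$, $\epsilon>0$ there is a natural number $$m\le C\left(\sqrt{\tfrac H\lambda}\log\tfrac H\lambda+\sqrt{\tfrac{HR}{\epsilon}}\log\tfrac H\lambda+\Big(\tfrac{\sqrt H\,\sigma}{\sqrt\lambda\,\epsilon}\Big)^{2/3}\log\tfrac H\lambda+\tfrac{\sigma^2}{\epsilon^2}\log^3\tfrac H\lambda\right)$$ such that, for every $d$, every $x_0\in\mathbb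 R^d$, every $F\in\mathcal F[H,\lambda;R]$ and every stochastic first-order oracle for $F$ with variance bound $\sigma^2$, recursive regularization with subroutine AC-SA² and $m$ allotted accesses makes at most $m$ oracle accesses and returns a point $\hat x$ with $\mathbb E\|\nabla F(\hat x)\|\le\epsilon$. -/

import Mathlib

open MeasureTheory ProbabilityTheory
open scoped Gradient

namespace StochOpt

/-- `ℝᵈ` with the Euclidean norm. -/
abbrev Vec (d : ℕ) : Type := EuclideanSpace ℝ (Fin d)

section FunctionClasses

/-- `F` is `H`-smooth: it is differentiable and has a quadratic upper bound at every point. -/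
structure IsSmooth {d : ℕ} (H : ℝ) (F : Vec d → ℝ) : Prop where
  differentiable : Differentiable ℝ F
  upper : ∀ x y : Vec d, F y ≤ F x + inner ℝ (∇ F x) (y - x) + H / 2 * ‖y - x‖ ^ 2

/-- `F` (differentiable) is `lam`-strongly convex: a quadratic lower bound at every point. -/
structure IsStronglyConvex {d : ℕ} (lam : ℝ) (F : Vec d → ℝ) : Prop where
  differentiable : Differentiable ℝ F
  lower : ∀ x y : Vec d, F x + inner ℝ (∇ F x) (y - x) + lam / 2 * ‖y - x‖ ^ 2 ≤ F y

/-- Domain-bounded objectives relative to the initial point `x₀`: `H`-smooth and `lam`-strongly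
convex functions having a minimizer at distance at most `R` from `x₀`. -/
structure IsDomainBounded {d : ℕ} (H lam R : ℝ) (x₀ : Vec d) (F : Vec d → ℝ) : Prop where
  smooth : IsSmooth H F
  stronglyConvex : IsStronglyConvex lam F
  exists_minimizer : ∃ xs : Vec d, (∀ y, F xs ≤ F y) ∧ ‖x₀ - xs‖ ≤ R

end FunctionClasses

section Oracles

/-- The information returned by a first-order oracle: a function value and a gradient. -/
abbrev Info (d : ℕ) : Type := ℝ × Vec d

/-- The answer `(f(x; z), ∇f(x; z))` of the stochastic first-order oracle given by `f`, to the
query `x` when `z` has been drawn. -/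
noncomputable def sfo {d : ℕ} {Z : Type*} (f : Vec d → Z → ℝ) (x : Vec d) (z : Z) : Info d :=
  (f x z, ∇ (fun y => f y z) x)

/-- `f` and the distribution `D` on `Z` specify a stochastic first-order oracle for `F` with
variance at most `σ ^ 2`. For each query point `f(·; z)` need only be differentiable there for
almost every `z`. The gradients are unbiased; if every `f(·; z)` is differentiable everywhere then
this holds automatically, see `IsSFO.of_differentiable`. -/
structure IsSFO {d : ℕ} {Z : Type*} [MeasurableSpace Z] (F : Vec d → ℝ) (σ : ℝ)
    (D : Measure Z) (f : Vec d → Z → ℝ) : Prop where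
  measurable_gradient : Measurable (fun p : Vec d × Z => ∇ (fun y => f y p.2) p.1)
  differentiable : ∀ x, ∀ᵐ z ∂D, DifferentiableAt ℝ (fun y => f y z) x
  integrable_value : ∀ x, Integrable (fun z => f x z) D
  mean_value : ∀ x, ∫ z, f x z ∂D = F x
  mean_gradient : ∀ x, ∫ z, ∇ (fun y => f y z) x ∂D = ∇ F x
  integrable_variance : ∀ x, Integrable (fun z => ‖∇ (fun y => f y z) x - ∇ F x‖ ^ 2) D
  variance_le : ∀ x, ∫ z, ‖∇ (fun y => f y z) x - ∇ F x‖ ^ 2 ∂D ≤ σ ^ 2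

end Oracles

section OracleFacts

open Filter Topology

/- The oracle notion contains every oracle given by functions `f(·; z)` that are differentiable
everywhere: there, measurability of the gradients and their unbiasedness follow from
`F(x) = E f(x; z)` and the variance bound. -/

theorem measurable_gradient_of_differentiable {d : ℕ} {Z : Type*} [MeasurableSpace Z] {f : Vec d → Z → ℝ}
    (hm : Measurable (fun p : Vec d × Z => f p.1 p.2))
    (hf : ∀ z, Differentiable ℝ (fun y => f y z)) :
    Measurable (fun p : Vec d × Z => ∇ (fun y => f y p.2) p.1) := by
  have key : ∀ v : Vec d, Measurable (fun p : Vec d × Z => inner ℝ v (∇ (fun y => f y p.2) p.1)) := by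
    intro v
    refine measurable_of_tendsto_metrizable
      (f := fun (n : ℕ) (p : Vec d × Z) => ((n : ℝ) + 1) * (f (p.1 + ((n : ℝ) + 1)⁻¹ • v) p.2 - f p.1 p.2)) ?_ ?_
    · intro n
      have : Measurable (fun p : Vec d × Z => f (p.1 + ((n : ℝ) + 1)⁻¹ • v) p.2) :=
        hm.comp (f := fun p : Vec d × Z => (p.1 + ((n : ℝ) + 1)⁻¹ • v, p.2)) (by fun_prop)
      fun_prop
    · rw [tendsto_pi_nhds]
      rintro ⟨x, z⟩
      have h1 := (hf z x).hasGradientAt.hasFDerivAt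
      have h2 := h1.lim v (c := fun n : ℕ => (n : ℝ) + 1) (α := ℕ) (l := atTop)
        (tendsto_norm_atTop_atTop.comp
          (tendsto_natCast_atTop_atTop.atTop_add tendsto_const_nhds))
      simpa [real_inner_comm] using h2
  have : (fun p : Vec d × Z => ∇ (fun y => f y p.2) p.1) = fun p =>
      ∑ i, inner ℝ (EuclideanSpace.basisFun (Fin d) ℝ i) (∇ (fun y => f y p.2) p.1) •
        EuclideanSpace.basisFun (Fin d) ℝ i := by
    funext p
    exact ((EuclideanSpace.basisFun (Fin d) ℝ).sum_repr' _).symm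
  rw [this]
  exact Finset.measurable_sum _ fun i _ => (key _).smul_const _

theorem ofReal_increment_sq_le {d : ℕ} {g : Vec d → ℝ} (hg : Differentiable ℝ g)
    (hm : Measurable (∇ g)) (x w : Vec d) :
    ENNReal.ofReal ((g (x + w) - g x) ^ 2) ≤
      ∫⁻ s in Set.Ioc (0 : ℝ) 1, ENNReal.ofReal ((inner ℝ (∇ g (x + s • w)) w) ^ 2) := by
  set φ : ℝ → ℝ := fun s => inner ℝ (∇ g (x + s • w)) w with hφ
  have hφm : Measurable φ := by
    have : Measurable (fun s : ℝ => ∇ g (x + s • w)) := hm.comp (by fun_prop)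
    exact this.inner_const
  by_cases hfin : ∫⁻ s in Set.Ioc (0 : ℝ) 1, ENNReal.ofReal ((φ s) ^ 2) = ⊤
  · rw [hfin]; exact le_top
  have hi2 : Integrable (fun s => φ s ^ 2) (volume.restrict (Set.Ioc (0 : ℝ) 1)) := by
    refine ⟨(hφm.pow_const 2).aestronglyMeasurable, ?_⟩
    rw [hasFiniteIntegral_iff_ofReal (ae_of_all _ fun s => sq_nonneg _)]
    exact lt_top_iff_ne_top.2 hfin
  have hL2 : MemLp φ 2 (volume.restrict (Set.Ioc (0 : ℝ) 1)) :=
    (memLp_two_iff_integrable_sq hφm.aestronglyMeasurable).2 hi2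
  have hi : Integrable φ (volume.restrict (Set.Ioc (0 : ℝ) 1)) := hL2.integrable (by norm_num)
  have hftc : ∫ s in (0 : ℝ)..1, φ s = g (x + w) - g x := by
    have := intervalIntegral.integral_eq_sub_of_hasDerivAt (a := 0) (b := 1)
      (f := fun s : ℝ => g (x + s • w)) (f' := φ) (fun s _ => by
        have h1 := (hg (x + s • w)).hasGradientAt.hasFDerivAt
        have h2 : HasDerivAt (fun s : ℝ => x + s • w) w s := by
          simpa using ((hasDerivAt_id s).smul_const w).const_add x
        simpa [hφ, Function.comp_def] using h1.comp_hasDerivAt s h2)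
      ((intervalIntegrable_iff_integrableOn_Ioc_of_le zero_le_one).2 hi)
    simpa using this
  rw [← ofReal_integral_eq_lintegral_ofReal hi2 (ae_of_all _ fun s => sq_nonneg _)]
  apply ENNReal.ofReal_le_ofReal
  rw [← hftc, intervalIntegral.integral_of_le zero_le_one]
  set c := ∫ s in Set.Ioc (0 : ℝ) 1, φ s
  have : 0 ≤ ∫ s in Set.Ioc (0 : ℝ) 1, (φ s - c) ^ 2 := integral_nonneg fun s => sq_nonneg _
  have e : (∫ s in Set.Ioc (0 : ℝ) 1, (φ s - c) ^ 2) =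
      (∫ s in Set.Ioc (0 : ℝ) 1, φ s ^ 2) - c ^ 2 := by
    have : ∀ s, (φ s - c) ^ 2 = φ s ^ 2 - (2 * c) * φ s + c ^ 2 := fun s => by ring
    simp_rw [this]
    have h1 : ∫ s in Set.Ioc (0 : ℝ) 1, (φ s ^ 2 - 2 * c * φ s + c ^ 2) =
        (∫ s in Set.Ioc (0 : ℝ) 1, (φ s ^ 2 - 2 * c * φ s)) + ∫ s in Set.Ioc (0 : ℝ) 1, c ^ 2 :=
      integral_add (hi2.sub (hi.const_mul _)) (integrable_const _)
    have h2 : ∫ s in Set.Ioc (0 : ℝ) 1, (φ s ^ 2 - 2 * c * φ s) =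
        (∫ s in Set.Ioc (0 : ℝ) 1, φ s ^ 2) - ∫ s in Set.Ioc (0 : ℝ) 1, 2 * c * φ s :=
      integral_sub hi2 (hi.const_mul _)
    rw [h1, h2, integral_const_mul]
    simp
    ring
  linarith

theorem IsSFO.of_differentiable {d : ℕ} {Z : Type*} [MeasurableSpace Z] {F : Vec d → ℝ} {σ : ℝ}
    {D : Measure Z} [IsProbabilityMeasure D] {f : Vec d → Z → ℝ}
    {lam : ℝ} (hlam : 0 ≤ lam) (hsc : IsStronglyConvex lam F)
    (hm : Measurable (fun p : Vec d × Z => f p.1 p.2))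
    (hf : ∀ z, Differentiable ℝ (fun y => f y z))
    (hi : ∀ x, Integrable (fun z => f x z) D) (hmean : ∀ x, ∫ z, f x z ∂D = F x)
    (hvi : ∀ x, Integrable (fun z => ‖∇ (fun y => f y z) x - ∇ F x‖ ^ 2) D)
    (hv : ∀ x, ∫ z, ‖∇ (fun y => f y z) x - ∇ F x‖ ^ 2 ∂D ≤ σ ^ 2) : IsSFO F σ D f := by
  have hmg := measurable_gradient_of_differentiable hm hf
  refine ⟨hmg, fun x => ae_of_all _ fun z => hf z x, hi, hmean, fun x => ?_, hvi, hv⟩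
  have hmgx : ∀ x, Measurable (fun z => ∇ (fun y => f y z) x) := fun x =>
    hmg.comp (measurable_const.prodMk measurable_id)
  have hL2 : ∀ x, MemLp (fun z => ∇ (fun y => f y z) x) 2 D := fun x => by
    have h1 : MemLp (fun z => ∇ (fun y => f y z) x - ∇ F x) 2 D :=
      (memLp_two_iff_integrable_sq_norm
        ((hmgx x).sub_const _).aestronglyMeasurable).2 (hvi x)
    simpa [Pi.add_def] using h1.add (memLp_const (∇ F x))
  have hint : ∀ x, Integrable (fun z => ∇ (fun y => f y z) x) D := fun x =>
    (hL2 x).integrable (by norm_num)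
  refine ext_inner_right ℝ fun v => ?_
  rw [real_inner_comm, ← integral_inner (hint x)]
  have hF := hsc.differentiable
  obtain ⟨B, hB⟩ : ∃ B : ℝ, ∀ y ∈ Metric.closedBall x ‖v‖, ‖∇ F y‖ ≤ B := by
    obtain ⟨B, hB⟩ := (isCompact_closedBall x (‖v‖ + 1)).exists_bound_of_continuousOn
      hF.continuous.continuousOn
    refine ⟨B + B, fun y hy => ?_⟩
    have hy1 := mem_closedBall_iff_norm.1 hy
    have b1 := abs_le.1 (hB y (mem_closedBall_iff_norm.2 (by linarith)))
    by_cases hg : ∇ F y = 0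
    · rw [hg, norm_zero]; linarith
    have hg0 : 0 < ‖∇ F y‖ := norm_pos_iff.2 hg
    set u : Vec d := ‖∇ F y‖⁻¹ • ∇ F y with hu
    have hu1 : ‖u‖ = 1 := by
      rw [hu, norm_smul, norm_inv, norm_norm, inv_mul_cancel₀ hg0.ne']
    have hiu : inner ℝ (∇ F y) u = ‖∇ F y‖ := by
      rw [hu, real_inner_smul_right, real_inner_self_eq_norm_sq]
      field_simp
    have b2 := abs_le.1 (hB (y + u) (mem_closedBall_iff_norm.2 (by
      have := norm_add_le (y - x) u
      rw [show y + u - x = y - x + u by abel]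
      linarith)))
    have h3 := hsc.lower y (y + u)
    rw [add_sub_cancel_left, hiu, hu1] at h3
    linarith
  set M : ℝ := 2 * σ ^ 2 + 2 * B ^ 2 with hM
  have hM0 : 0 ≤ M := by positivity
  have hsq : ∀ y ∈ Metric.closedBall x ‖v‖, ∫ z, ‖∇ (fun y => f y z) y‖ ^ 2 ∂D ≤ M := by
    intro y hy
    calc ∫ z, ‖∇ (fun y => f y z) y‖ ^ 2 ∂D
        ≤ ∫ z, (2 * ‖∇ (fun y => f y z) y - ∇ F y‖ ^ 2 + 2 * B ^ 2) ∂D := by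
          refine integral_mono ((memLp_two_iff_integrable_sq_norm
            (hmgx y).aestronglyMeasurable).1 (hL2 y))
            (((hvi y).const_mul _).add (integrable_const _)) fun z => ?_
          have h1 := norm_le_norm_sub_add (∇ (fun y => f y z) y) (∇ F y)
          have h2 := hB y hy
          have h3 := norm_nonneg (∇ (fun y => f y z) y)
          have h4 : ‖∇ (fun y => f y z) y‖ ≤ ‖∇ (fun y => f y z) y - ∇ F y‖ + B := by linarith
          have h5 := pow_le_pow_left₀ h3 h4 2
          have h6 := sq_nonneg (‖∇ (fun y => f y z) y - ∇ F y‖ - B)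
          simp only
          nlinarith
      _ ≤ M := by
          rw [integral_add ((hvi y).const_mul _) (integrable_const _), integral_const_mul]
          have := hv y
          simp only [integral_const, probReal_univ, one_smul]
          linarith
  have hin : ∀ y ∈ Metric.closedBall x ‖v‖, ∀ w : Vec d,
      ∫⁻ z, ENNReal.ofReal ((inner ℝ (∇ (fun y => f y z) y) w) ^ 2) ∂D ≤
        ENNReal.ofReal (M * ‖w‖ ^ 2) := by
    intro y hy w
    have h0 := ((memLp_two_iff_integrable_sq_norm
            (hmgx y).aestronglyMeasurable).1 (hL2 y)).mul_const (‖w‖ ^ 2)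
    calc _ ≤ ∫⁻ z, ENNReal.ofReal (‖∇ (fun y => f y z) y‖ ^ 2 * ‖w‖ ^ 2) ∂D := by
          refine lintegral_mono fun z => ENNReal.ofReal_le_ofReal ?_
          rw [← mul_pow, ← sq_abs]
          exact pow_le_pow_left₀ (abs_nonneg _) (abs_real_inner_le_norm _ _) 2
      _ = ENNReal.ofReal (∫ z, ‖∇ (fun y => f y z) y‖ ^ 2 * ‖w‖ ^ 2 ∂D) :=
          (ofReal_integral_eq_lintegral_ofReal h0 (ae_of_all _ fun z => by positivity)).symm
      _ ≤ _ := by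
          rw [integral_mul_const]
          exact ENNReal.ofReal_le_ofReal (mul_le_mul_of_nonneg_right (hsq y hy) (by positivity))
  have hinc : ∀ w : Vec d, ‖w‖ ≤ ‖v‖ →
      ∫⁻ z, ENNReal.ofReal ((f (x + w) z - f x z) ^ 2) ∂D ≤ ENNReal.ofReal (M * ‖w‖ ^ 2) := by
    intro w hw
    calc _ ≤ ∫⁻ z, (∫⁻ s in Set.Ioc (0 : ℝ) 1,
            ENNReal.ofReal ((inner ℝ (∇ (fun y => f y z) (x + s • w)) w) ^ 2)) ∂D :=
          lintegral_mono fun z => ofReal_increment_sq_le (hf z)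
            (hmg.comp (measurable_id.prodMk measurable_const)) x w
      _ = ∫⁻ s in Set.Ioc (0 : ℝ) 1, ∫⁻ z,
            ENNReal.ofReal ((inner ℝ (∇ (fun y => f y z) (x + s • w)) w) ^ 2) ∂D := by
          refine lintegral_lintegral_swap (Measurable.aemeasurable ?_)
          have : Measurable (fun p : Z × ℝ => ∇ (fun y => f y p.1) (x + p.2 • w)) :=
            hmg.comp (f := fun p : Z × ℝ => (x + p.2 • w, p.1)) (by fun_prop)
          exact ((this.inner_const).pow_const 2).ennreal_ofReal
      _ ≤ ∫⁻ s in Set.Ioc (0 : ℝ) 1, ENNReal.ofReal (M * ‖w‖ ^ 2) := by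
          refine setLIntegral_mono measurable_const fun s hs => hin _ ?_ w
          rw [mem_closedBall_iff_norm, add_sub_cancel_left, norm_smul, Real.norm_eq_abs,
            abs_of_pos hs.1]
          nlinarith [hs.2, norm_nonneg w]
      _ = _ := by simp
  set a : Z → ℝ := fun z => inner ℝ (∇ (fun y => f y z) x) v with ha
  set q : ℕ → Z → ℝ := fun n z => ((n : ℝ) + 1) * (f (x + ((n : ℝ) + 1)⁻¹ • v) z - f x z) with hq
  have lim : ∀ g : Vec d → ℝ, Differentiable ℝ g → Tendsto (fun n : ℕ =>
      ((n : ℝ) + 1) * (g (x + ((n : ℝ) + 1)⁻¹ • v) - g x)) atTop (𝓝 (inner ℝ (∇ g x) v)) := by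
    intro g hg
    simpa using (hg x).hasGradientAt.hasFDerivAt.lim v (c := fun n : ℕ => (n : ℝ) + 1) (α := ℕ)
      (l := atTop) (tendsto_norm_atTop_atTop.comp
          (tendsto_natCast_atTop_atTop.atTop_add tendsto_const_nhds))
  have hqi : ∀ n, Integrable (q n) D := fun n => ((hi _).sub (hi _)).const_mul _
  have hai : Integrable a D := (hint x).inner_const v
  have ham : Measurable a := (hmgx x).inner_const
  have hqm : ∀ n, Measurable (q n) := fun n => by
    have : ∀ y, Measurable (f y) := fun y => hm.comp (measurable_const.prodMk measurable_id)
    exact ((this _).sub (this _)).const_mul _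
  have hqL : Tendsto (fun n => ∫ z, q n z ∂D) atTop (𝓝 (inner ℝ (∇ F x) v)) := by
    refine (lim F hF).congr fun n => ?_
    simp only [hq]
    rw [integral_const_mul, integral_sub (hi _) (hi _), hmean, hmean]
  set K : ℝ := 4 * (M * ‖v‖ ^ 2) with hK
  have hK0 : 0 ≤ K := by positivity
  have hq2 : ∀ n, ∫⁻ z, ENNReal.ofReal ((q n z) ^ 2) ∂D ≤ ENNReal.ofReal (M * ‖v‖ ^ 2) := by
    intro n
    have hn : (0 : ℝ) < (n : ℝ) + 1 := by positivity
    have hn1 : ‖((n : ℝ) + 1)⁻¹ • v‖ = ((n : ℝ) + 1)⁻¹ * ‖v‖ := by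
      rw [norm_smul, Real.norm_eq_abs, abs_of_pos (inv_pos.2 hn)]
    have h1 := hinc (((n : ℝ) + 1)⁻¹ • v) (by
      rw [hn1]
      exact mul_le_of_le_one_left (norm_nonneg v) (inv_le_one_of_one_le₀ (by simp)))
    calc _ = ∫⁻ z, ENNReal.ofReal (((n : ℝ) + 1) ^ 2) *
            ENNReal.ofReal ((f (x + ((n : ℝ) + 1)⁻¹ • v) z - f x z) ^ 2) ∂D := by
          refine lintegral_congr fun z => ?_
          rw [← ENNReal.ofReal_mul (by positivity), ← mul_pow]
      _ = ENNReal.ofReal (((n : ℝ) + 1) ^ 2) *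
            ∫⁻ z, ENNReal.ofReal ((f (x + ((n : ℝ) + 1)⁻¹ • v) z - f x z) ^ 2) ∂D :=
          lintegral_const_mul' _ _ ENNReal.ofReal_ne_top
      _ ≤ ENNReal.ofReal (((n : ℝ) + 1) ^ 2) *
            ENNReal.ofReal (M * ‖((n : ℝ) + 1)⁻¹ • v‖ ^ 2) := by gcongr
      _ = _ := by
          rw [← ENNReal.ofReal_mul (by positivity), hn1]
          congr 1
          field_simp
  have hr2 : ∀ n, Integrable (fun z => (q n z - a z) ^ 2) D ∧ ∫ z, (q n z - a z) ^ 2 ∂D ≤ K := by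
    intro n
    have hle : ∫⁻ z, ENNReal.ofReal ((q n z - a z) ^ 2) ∂D ≤ ENNReal.ofReal K := by
      calc _ ≤ ∫⁻ z, (ENNReal.ofReal 2 * ENNReal.ofReal ((q n z) ^ 2) +
              ENNReal.ofReal 2 * ENNReal.ofReal ((a z) ^ 2)) ∂D := by
            refine lintegral_mono fun z => ?_
            rw [← ENNReal.ofReal_mul (by norm_num), ← ENNReal.ofReal_mul (by norm_num),
              ← ENNReal.ofReal_add (by positivity) (by positivity)]
            refine ENNReal.ofReal_le_ofReal ?_
            nlinarith [sq_nonneg (q n z + a z)]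
        _ = ENNReal.ofReal 2 * ∫⁻ z, ENNReal.ofReal ((q n z) ^ 2) ∂D +
              ENNReal.ofReal 2 * ∫⁻ z, ENNReal.ofReal ((a z) ^ 2) ∂D := by
            rw [lintegral_add_right _ (((ham.pow_const 2).ennreal_ofReal).const_mul _),
              lintegral_const_mul' _ _ ENNReal.ofReal_ne_top,
              lintegral_const_mul' _ _ ENNReal.ofReal_ne_top]
        _ ≤ ENNReal.ofReal 2 * ENNReal.ofReal (M * ‖v‖ ^ 2) +
              ENNReal.ofReal 2 * ENNReal.ofReal (M * ‖v‖ ^ 2) := by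
            gcongr
            · exact hq2 n
            · exact hin x (Metric.mem_closedBall_self (norm_nonneg v)) v
        _ = _ := by
            rw [← ENNReal.ofReal_mul (by norm_num), ← ENNReal.ofReal_add (by positivity) (by positivity)]
            congr 1
            rw [hK]; ring
    have hI : Integrable (fun z => (q n z - a z) ^ 2) D := by
      refine ⟨(((hqm n).sub ham).pow_const 2).aestronglyMeasurable, ?_⟩
      rw [hasFiniteIntegral_iff_ofReal (ae_of_all _ fun s => sq_nonneg _)]
      exact hle.trans_lt ENNReal.ofReal_lt_top
    refine ⟨hI, ?_⟩
    rwa [← ofReal_integral_eq_lintegral_ofReal hI (ae_of_all _ fun s => sq_nonneg _),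
      ENNReal.ofReal_le_ofReal_iff hK0] at hle
  have hqa : Tendsto (fun n => ∫ z, q n z ∂D) atTop (𝓝 (∫ z, a z ∂D)) := by
    rw [Metric.tendsto_atTop]
    intro δ hδ
    set L : ℝ := 2 * (K + 1) / δ with hL
    have hL0 : 0 < L := by positivity
    have hdct : Tendsto (fun n => ∫ z, min |q n z - a z| L ∂D) atTop (𝓝 (∫ z, (0 : ℝ) ∂D)) := by
      refine tendsto_integral_of_dominated_convergence (fun _ => L) (fun n => ?_)
        (integrable_const L) (fun n => ae_of_all _ fun z => ?_) (ae_of_all _ fun z => ?_)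
      · exact ((((hqm n).sub ham).abs).min measurable_const).aestronglyMeasurable
      · rw [Real.norm_eq_abs, abs_of_nonneg (le_min (abs_nonneg _) hL0.le)]
        exact min_le_right _ _
      · have h1 : Tendsto (fun n => |q n z - a z|) atTop (𝓝 0) := by
          have h0 := ((lim _ (hf z)).sub_const (a z)).abs
          rwa [show inner ℝ (∇ (fun y => f y z) x) v - a z = 0 from sub_self _, abs_zero] at h0
        simpa [hL0.le] using h1.min (tendsto_const_nhds (x := L))
    rw [integral_zero, Metric.tendsto_atTop] at hdct
    obtain ⟨N, hN⟩ := hdct (δ / 2) (by positivity)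
    refine ⟨N, fun n hn => ?_⟩
    have h1 := lt_of_abs_lt (by simpa [Real.dist_eq] using hN n hn)
    have hmi : Integrable (fun z => min |q n z - a z| L) D :=
      ((hqi n).sub hai).abs.mono
        ((((hqm n).sub ham).abs).min measurable_const).aestronglyMeasurable
        (ae_of_all _ fun z => by
          simp only [Real.norm_eq_abs, abs_of_nonneg (le_min (abs_nonneg (q n z - a z)) hL0.le)]
          simp)
    rw [Real.dist_eq, ← integral_sub (hqi n) hai]
    calc |∫ z, (q n z - a z) ∂D| ≤ ∫ z, |q n z - a z| ∂D := abs_integral_le_integral_abs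
      _ ≤ ∫ z, (min |q n z - a z| L + (q n z - a z) ^ 2 / L) ∂D := by
          refine integral_mono ((hqi n).sub hai).abs (hmi.add ((hr2 n).1.div_const L)) fun z => ?_
          simp only
          rcases le_total |q n z - a z| L with hc | hc
          · rw [min_eq_left hc]
            have : 0 ≤ (q n z - a z) ^ 2 / L := by positivity
            linarith
          · have : |q n z - a z| ≤ (q n z - a z) ^ 2 / L := by
              rw [le_div_iff₀ hL0, ← sq_abs, sq]
              exact mul_le_mul_of_nonneg_left hc (abs_nonneg _)
            have h0 : 0 ≤ min |q n z - a z| L := le_min (abs_nonneg _) hL0.le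
            linarith
      _ = (∫ z, min |q n z - a z| L ∂D) + (∫ z, (q n z - a z) ^ 2 ∂D) / L := by
          rw [integral_add hmi ((hr2 n).1.div_const L), integral_div]
      _ < δ / 2 + δ / 2 := by
          have h2 : (∫ z, (q n z - a z) ^ 2 ∂D) / L ≤ δ / 2 := by
            rw [div_le_iff₀ hL0, hL]
            have := (hr2 n).2
            have e : δ / 2 * (2 * (K + 1) / δ) = K + 1 := by field_simp
            linarith
          linarith
      _ = δ := by ring
  have := tendsto_nhds_unique hqa hqL
  simpa [ha, real_inner_comm] using this

end OracleFacts

section OracleAlgorithms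

/-- A deterministic algorithm with access to an oracle that takes queries in `X` and answers in
`I`: it either stops with an output, or makes one query and continues depending on the answer. -/
inductive OracleAlg (X I A : Type) : Type where
  | ret (a : A) : OracleAlg X I A
  | query (x : X) (k : I → OracleAlg X I A) : OracleAlg X I A

namespace OracleAlg

variable {X I A B : Type} {Z : Type*}

/-- Run one algorithm, then another one that starts from its output. -/
def bind : OracleAlg X I A → (A → OracleAlg X I B) → OracleAlg X I B
  | ret a, g => g a
  | query x k, g => query x (fun i => bind (k i) g)

/-- The same algorithm, run on a modified oracle: the answer `i` to the query `x` is replaced by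
`φ x i`. -/
def mapAnswers (φ : X → I → I) : OracleAlg X I A → OracleAlg X I A
  | ret a => ret a
  | query x k => query x (fun i => mapAnswers φ (k (φ x i)))

/-- The output, when the oracle answers the query `x` by `O x z` with `z` the next, not yet used
entry of the sample sequence. -/
def output (O : X → Z → I) : OracleAlg X I A → (ℕ → Z) → A
  | ret a, _ => a
  | query x k, z => output O (k (O x (z 0))) (fun i => z (i + 1))

/-- The number of oracle accesses in the run described at `output`. -/
def numQueries (O : X → Z → I) : OracleAlg X I A → (ℕ → Z) → ℕ
  | ret _, _ => 0
  | query x k, z => numQueries O (k (O x (z 0))) (fun i => z (i + 1)) + 1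

end OracleAlg

end OracleAlgorithms

section Algorithms

/-- Iteration `t ≥ 1` of AC-SA, acting on the pair `(x_{t-1}, x_{t-1}^{ag})`. -/
noncomputable def acsaStep {d : ℕ} (H lam : ℝ) (t : ℕ) (s : Vec d × Vec d) :
    OracleAlg (Vec d) (Info d) (Vec d × Vec d) :=
  let α : ℝ := 2 / ((t : ℝ) + 1)
  let γ : ℝ := 4 * H / ((t : ℝ) * ((t : ℝ) + 1))
  let md : Vec d :=
    ((1 - α) * (lam + γ) / (γ + (1 - α ^ 2) * lam)) • s.2 +
      (α * ((1 - α) * lam + γ) / (γ + (1 - α ^ 2) * lam)) • s.1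
  .query md fun info =>
    let x : Vec d :=
      (α * lam / (lam + γ)) • md + (((1 - α) * lam + γ) / (lam + γ)) • s.1 -
        (α / (lam + γ)) • info.2
    .ret (x, α • x + (1 - α) • s.2)

/-- The first `t` iterations of AC-SA from `x₀`. -/
noncomputable def acsaLoop {d : ℕ} (H lam : ℝ) (x₀ : Vec d) :
    ℕ → OracleAlg (Vec d) (Info d) (Vec d × Vec d)
  | 0 => .ret (x₀, x₀)
  | t + 1 => (acsaLoop H lam x₀ t).bind (acsaStep H lam (t + 1))

/-- AC-SA with `m` oracle accesses, for `H`-smooth and `lam`-strongly convex objectives. -/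
noncomputable def acsa {d : ℕ} (H lam : ℝ) (m : ℕ) (x₀ : Vec d) :
    OracleAlg (Vec d) (Info d) (Vec d) :=
  (acsaLoop H lam x₀ m).bind fun s => .ret s.2

/-- AC-SA²: two runs of AC-SA with half of the accesses each, the second one starting from the
output of the first. -/
noncomputable def acsaSq {d : ℕ} (H lam : ℝ) (m : ℕ) (x₀ : Vec d) :
    OracleAlg (Vec d) (Info d) (Vec d) :=
  (acsa H lam (m / 2) x₀).bind fun x₁ => acsa H lam (m / 2) x₁

/-- Turns an answer of the oracle for `F` to the query `x` into one for
`F(x) + lam * ∑_{k = 1}^{t} 2^{k-1} ‖x - c k‖²`, by adding the value and the gradient of the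
regularizer. -/
noncomputable def regularize {d : ℕ} (lam : ℝ) (t : ℕ) (c : ℕ → Vec d) (x : Vec d)
    (i : Info d) : Info d :=
  (i.1 + lam * ∑ k ∈ Finset.Icc 1 t, 2 ^ (k - 1) * ‖x - c k‖ ^ 2,
    i.2 + ∑ k ∈ Finset.Icc 1 t, (lam * 2 ^ k) • (x - c k))

/-- The first `t` rounds of recursive regularization with the subroutine `sub`, which is called as
`sub H' lam' n x` on an `H'`-smooth, `lam'`-strongly convex objective, with `n` oracle accesses and
initial point `x`. The result `c` lists the iterates: `c 0 = x₀` and `c k` is the output of round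
`k` for `1 ≤ k ≤ t`. Round `t + 1` calls `sub` on the `t`-th regularized objective, whose
regularizer contributes `lam * ∑_{k = 1}^{t} 2^k` to both the smoothness and the
strong-convexity parameter. -/
noncomputable def recRegRounds {d : ℕ}
    (sub : ℝ → ℝ → ℕ → Vec d → OracleAlg (Vec d) (Info d) (Vec d))
    (H lam : ℝ) (n : ℕ) (x₀ : Vec d) : ℕ → OracleAlg (Vec d) (Info d) (ℕ → Vec d)
  | 0 => .ret fun _ => x₀
  | t + 1 => (recRegRounds sub H lam n x₀ t).bind fun c =>
      ((sub (H + lam * ∑ k ∈ Finset.Icc 1 t, 2 ^ k) (lam + lam * ∑ k ∈ Finset.Icc 1 t, 2 ^ k)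
        n (c t)).mapAnswers (regularize lam t c)).bind fun x =>
          .ret (Function.update c (t + 1) x)

/-- The number of rounds, `⌊log₂ (H / lam)⌋`. -/
noncomputable def numRounds (H lam : ℝ) : ℕ := ⌊Real.logb 2 (H / lam)⌋₊

/-- The recursive regularization meta-algorithm with subroutine `sub` and `m` allotted oracle
accesses, equally divided (with rounding down) among the rounds. -/
noncomputable def recReg {d : ℕ}
    (sub : ℝ → ℝ → ℕ → Vec d → OracleAlg (Vec d) (Info d) (Vec d))
    (H lam : ℝ) (m : ℕ) (x₀ : Vec d) : OracleAlg (Vec d) (Info d) (Vec d) :=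
  (recRegRounds sub H lam (m / numRounds H lam) x₀ (numRounds H lam)).bind fun c =>
    .ret (c (numRounds H lam))

end Algorithms

end StochOpt

/-!
Each round of recursive regularization minimizes a strongly convex function whose condition number
is about half that of the round before, and adds a regularizer around the point found. Let `c k` be the
output of round `k`, let `u k` be the minimizer of the objective with `k` regularizers, and let
`b k = lam * 2 ^ k * ‖c k - u (k - 1)‖` be the error of round `k` (`roundError`). Adding a regularizer
around `c k` moves the minimizer towards `c k`, by at most `2 * ‖c k - u (k - 1)‖`. Hence the gradient
of the regularizer, and with it the gradient of `F` at the last iterate, is bounded by a constant times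
`∑ b k` (`norm_grad_le`).

To bound `E ∑ b k`, the potential `acsaPotential` shows that AC-SA with `n` accesses on an `H'`-smooth,
`mu`-strongly convex objective maps a squared distance `D²` to the minimizer to at most
`q D² + 4 σ² / (mu² n)` in expectation, where `q = 4 H' / (mu n²)`; for AC-SA² and `q ≤ 1` the factor
becomes `q²` (`expect_acsaSq_le`). If `n² ≥ 16 H / lam`, then the expected error of a round is at most
half of the error of the preceding round plus a noise term `w` with `w² = 32 σ² / n`
(`expect_round_le`). The errors therefore sum to a constant times the error of the first round plus
`T w`, where `T` is the number of rounds (`expect_recRegRounds_le`). It remains to choose `n` of order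
`√(H / lam) + √(H R / ε) + T² σ² / ε²` and `m = 2 n T`.

Two devices keep the probability and the calculus light. The expectation of a loss of the output is
computed by iterated integration along the algorithm (`OracleAlg.expect`), so that conditional
expectations given the past never appear; `OracleAlg.lintegral_output_of_iIndepFun` identifies it with
the expectation over an i.i.d. sample sequence. And the objectives enter only through quadratic bounds
with an abstract gradient field (`QuadBounds`), which regularization visibly preserves.
-/

namespace StochOpt

open scoped ENNReal

/-! ### Expectation calculus for oracle algorithms -/

/-- Prepending an independent `D`-sample to an i.i.d. sequence of `D`-samples gives again an i.i.d.
sequence. -/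
theorem measurePreserving_cons {Z : Type*} [MeasurableSpace Z] (D : Measure Z)
    [IsProbabilityMeasure D] :
    MeasurePreserving (fun p : Z × (ℕ → Z) => (fun i => Nat.casesOn i p.1 p.2 : ℕ → Z))
      (D.prod (Measure.infinitePi fun _ : ℕ => D)) (Measure.infinitePi fun _ : ℕ => D) := by
  have hm : Measurable
      (fun p : Z × (ℕ → Z) => (fun i => Nat.casesOn i p.1 p.2 : ℕ → Z)) := by
    refine measurable_pi_iff.2 fun i => ?_
    cases i with
    | zero => exact measurable_fst
    | succ i => exact (measurable_pi_apply i).comp measurable_snd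
  refine ⟨hm, Measure.eq_infinitePi _ fun s t ht => ?_⟩
  classical
  obtain ⟨N, hN⟩ := s.exists_nat_subset_range
  -- Enlarge the index set of the cylinder to an initial segment `{0, …, N}`.
  set t' : ℕ → Set Z := fun i => if i ∈ s then t i else Set.univ with ht'
  have ht'm : ∀ i, MeasurableSet (t' i) := fun i => by
    by_cases h : i ∈ s <;> simp [ht', h, ht]
  have hN' : s ⊆ Finset.range (N + 1) :=
    hN.trans (Finset.range_mono (Nat.le_succ N))
  have hset : (s : Set ℕ).pi t = (Finset.range (N + 1) : Set ℕ).pi t' := by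
    ext x
    constructor
    · intro hx i _
      by_cases h : i ∈ s
      · simpa [ht', h] using hx i h
      · simp [ht', h]
    · intro hx i hi
      have := hx i (hN' hi)
      simpa [ht', Finset.mem_coe.1 hi] using this
  have hprod : ∏ i ∈ s, D (t i) = ∏ i ∈ Finset.range (N + 1), D (t' i) := by
    rw [← Finset.prod_subset hN']
    · exact Finset.prod_congr rfl fun i hi => by simp [ht', hi]
    · intro i _ hi
      simp [ht', hi]
  have hpre : (fun p : Z × (ℕ → Z) => (fun i => Nat.casesOn i p.1 p.2 : ℕ → Z)) ⁻¹'
      ((Finset.range (N + 1) : Set ℕ).pi t') =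
      t' 0 ×ˢ (Finset.range N : Set ℕ).pi (fun i => t' (i + 1)) := by
    ext p
    constructor
    · intro hp
      exact ⟨hp 0 (by simp), fun i hi => hp (i + 1) (by simpa using hi)⟩
    · rintro ⟨h0, h1⟩ i hi
      cases i with
      | zero => exact h0
      | succ i => exact h1 i (by simpa using hi)
  rw [hset, hprod, Measure.map_apply hm (.pi (Finset.countable_toSet _) fun i _ => ht'm i), hpre,
    Measure.prod_prod, Measure.infinitePi_pi _ (fun i _ => ht'm _), Finset.prod_range_succ',
    mul_comm]

namespace OracleAlg

variable {X I A B : Type} {Z : Type*}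

/-- The expectation of the loss `φ` of the output, when each query is answered with a fresh sample
from `D`. It is defined by iterated integration, without reference to a sample sequence. In this form
sequential composition becomes substitution (`expect_bind`) and no measurability of the intermediate
losses is required. -/
noncomputable def expect [MeasurableSpace Z] (D : Measure Z) (O : X → Z → I) :
    OracleAlg X I A → (A → ℝ≥0∞) → ℝ≥0∞
  | ret a, φ => φ a
  | query x k, φ => ∫⁻ z, expect D O (k (O x z)) φ ∂D

section Expect

variable [MeasurableSpace Z] {D : Measure Z} {O : X → Z → I}

theorem expect_bind (a : OracleAlg X I A) (g : A → OracleAlg X I B) (φ : B → ℝ≥0∞) :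
    (a.bind g).expect D O φ = a.expect D O fun x => (g x).expect D O φ := by
  induction a with
  | ret a => rfl
  | query x k ih => exact lintegral_congr fun z => ih _

theorem expect_mono (a : OracleAlg X I A) {φ ψ : A → ℝ≥0∞} (h : ∀ x, φ x ≤ ψ x) :
    a.expect D O φ ≤ a.expect D O ψ := by
  induction a with
  | ret a => exact h a
  | query x k ih => exact lintegral_mono fun z => ih _

theorem expect_add_const [IsProbabilityMeasure D] (a : OracleAlg X I A) (φ : A → ℝ≥0∞)
    (c : ℝ≥0∞) : a.expect D O (fun x => φ x + c) = a.expect D O φ + c := by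
  induction a with
  | ret a => rfl
  | query x k ih =>
    simp only [expect, ih]
    rw [lintegral_add_right _ measurable_const]
    simp

theorem expect_const_mul (a : OracleAlg X I A) (φ : A → ℝ≥0∞) {c : ℝ≥0∞} (hc : c ≠ ∞) :
    a.expect D O (fun x => c * φ x) = c * a.expect D O φ := by
  induction a with
  | ret a => rfl
  | query x k ih =>
    simp only [expect, ih]
    rw [lintegral_const_mul' _ _ hc]

/-- Affine images of a loss that is known to have expectation at most `M`. -/
theorem expect_affine_le [IsProbabilityMeasure D] (a : OracleAlg X I A) {φ ψ : A → ℝ} {M c b : ℝ}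
    (hφ : a.expect D O (fun x => .ofReal (φ x)) ≤ .ofReal M) (hM : 0 ≤ M) (hc : 0 ≤ c) (hb : 0 ≤ b)
    (h : ∀ x, ψ x ≤ c * φ x + b) :
    a.expect D O (fun x => .ofReal (ψ x)) ≤ .ofReal (c * M + b) := by
  calc a.expect D O (fun x => .ofReal (ψ x))
      ≤ a.expect D O (fun x => ENNReal.ofReal c * .ofReal (φ x) + .ofReal b) := by
        refine a.expect_mono fun x => ?_
        rw [← ENNReal.ofReal_mul hc]
        exact (ENNReal.ofReal_le_ofReal (h x)).trans ENNReal.ofReal_add_le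
    _ ≤ ENNReal.ofReal c * .ofReal M + .ofReal b := by
        rw [expect_add_const, expect_const_mul _ _ ENNReal.ofReal_ne_top]
        gcongr
    _ = _ := by
        rw [← ENNReal.ofReal_mul hc, ← ENNReal.ofReal_add (by positivity) hb]

theorem expect_mapAnswers (ψ : X → I → I) (a : OracleAlg X I A) (φ : A → ℝ≥0∞) :
    (a.mapAnswers ψ).expect D O φ = a.expect D (fun x z => ψ x (O x z)) φ := by
  induction a with
  | ret a => rfl
  | query x k ih => exact lintegral_congr fun z => ih _

/-- `expect` is the expectation over an i.i.d. sample sequence, provided that the output depends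
measurably on that sequence. -/
theorem lintegral_output [IsProbabilityMeasure D] [MeasurableSpace A] {φ : A → ℝ≥0∞}
    (hφ : Measurable φ) (a : OracleAlg X I A) (ha : Measurable fun z => a.output O z) :
    ∫⁻ z, φ (a.output O z) ∂(Measure.infinitePi fun _ : ℕ => D) = a.expect D O φ := by
  induction a with
  | ret a => simp [output, expect]
  | query x k ih =>
    have hmp := measurePreserving_cons D
    refine (hmp.lintegral_comp (hφ.comp ha)).symm.trans ((lintegral_prod _
      ((hφ.comp (ha.comp hmp.measurable)).aemeasurable)).trans (lintegral_congr fun z₀ => ?_))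
    exact ih (O x z₀) (ha.comp (hmp.measurable.comp measurable_prodMk_left))

end Expect

theorem output_bind (O : X → Z → I) (a : OracleAlg X I A) (g : A → OracleAlg X I B) (z : ℕ → Z) :
    (a.bind g).output O z =
      (g (a.output O z)).output O (fun i => z (i + a.numQueries O z)) := by
  induction a generalizing z with
  | ret a => rfl
  | query x k ih => simp only [bind, output, numQueries, ih]; rfl

theorem numQueries_bind (O : X → Z → I) (a : OracleAlg X I A) (g : A → OracleAlg X I B)
    (z : ℕ → Z) :
    (a.bind g).numQueries O z = a.numQueries O z +
      (g (a.output O z)).numQueries O (fun i => z (i + a.numQueries O z)) := by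
  induction a generalizing z with
  | ret a => simp [bind, numQueries, output]
  | query x k ih =>
    simp only [bind, output, numQueries, ih]
    rw [add_right_comm]
    rfl

theorem output_mapAnswers (O : X → Z → I) (ψ : X → I → I) (a : OracleAlg X I A) (z : ℕ → Z) :
    (a.mapAnswers ψ).output O z = a.output (fun x z => ψ x (O x z)) z := by
  induction a generalizing z with
  | ret a => rfl
  | query x k ih => exact ih _ _

theorem numQueries_mapAnswers (O : X → Z → I) (ψ : X → I → I) (a : OracleAlg X I A) (z : ℕ → Z) :
    (a.mapAnswers ψ).numQueries O z = a.numQueries (fun x z => ψ x (O x z)) z := by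
  induction a generalizing z with
  | ret a => rfl
  | query x k ih => exact congrArg (· + 1) (ih _ _)

end OracleAlg

/-! ### Oracle accesses -/

section Queries

variable {d : ℕ} {Z : Type*} (O : Vec d → Z → Info d)

theorem numQueries_acsaLoop (H lam : ℝ) (x₀ : Vec d) (t : ℕ) (z : ℕ → Z) :
    (acsaLoop H lam x₀ t).numQueries O z = t := by
  induction t with
  | zero => rfl
  | succ t ih => rw [acsaLoop, OracleAlg.numQueries_bind, ih]; rfl

theorem numQueries_acsa (H lam : ℝ) (m : ℕ) (x₀ : Vec d) (z : ℕ → Z) :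
    (acsa H lam m x₀).numQueries O z = m := by
  rw [acsa, OracleAlg.numQueries_bind, numQueries_acsaLoop]; rfl

theorem numQueries_acsaSq (H lam : ℝ) (m : ℕ) (x₀ : Vec d) (z : ℕ → Z) :
    (acsaSq H lam m x₀).numQueries O z = m / 2 + m / 2 := by
  rw [acsaSq, OracleAlg.numQueries_bind, numQueries_acsa, numQueries_acsa]

theorem numQueries_recRegRounds_acsaSq (H lam : ℝ) (n : ℕ) (x₀ : Vec d) (t : ℕ) (z : ℕ → Z) :
    (recRegRounds acsaSq H lam n x₀ t).numQueries O z = t * (n / 2 + n / 2) := by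
  induction t with
  | zero => simp [recRegRounds, OracleAlg.numQueries]
  | succ t ih =>
    rw [recRegRounds, OracleAlg.numQueries_bind, OracleAlg.numQueries_bind,
      OracleAlg.numQueries_mapAnswers, numQueries_acsaSq, ih, add_mul, one_mul]
    rfl

theorem numQueries_recReg_acsaSq_le (H lam : ℝ) (m : ℕ) (x₀ : Vec d) (z : ℕ → Z) :
    (recReg acsaSq H lam m x₀).numQueries O z ≤ m := by
  rw [recReg, OracleAlg.numQueries_bind, numQueries_recRegRounds_acsaSq]
  change _ + 0 ≤ m
  calc numRounds H lam * (m / numRounds H lam / 2 + m / numRounds H lam / 2) + 0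
      ≤ numRounds H lam * (m / numRounds H lam) := Nat.mul_le_mul_left _ (by omega)
    _ ≤ m := Nat.mul_div_le _ _

end Queries

/-! ### Measurability of the outputs -/

section Measurability

variable {d : ℕ} {Z : Type*} [MeasurableSpace Z]

/-- The state of AC-SA depends measurably on any parameter `p` that enters measurably into the
oracle's gradients, the initial point and the samples. -/
theorem measurable_output_acsaLoop {Q : Type*} [MeasurableSpace Q] {O : Q → Vec d → Z → Info d}
    (hO : Measurable fun q : Q × Vec d × Z => (O q.1 q.2.1 q.2.2).2) {x₀ : Q → Vec d}
    (hx₀ : Measurable x₀) {s : Q → ℕ → Z} (hs : Measurable s) (H lam : ℝ) (t : ℕ) :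
    Measurable fun p => (acsaLoop H lam (x₀ p) t).output (O p) (s p) := by
  induction t with
  | zero => exact hx₀.prodMk hx₀
  | succ t ih =>
    simp only [acsaLoop, OracleAlg.output_bind, numQueries_acsaLoop]
    have h1 := ih.fst
    have h2 := ih.snd
    have h3 : Measurable fun p => s p (0 + t) := (measurable_pi_apply (0 + t)).comp hs
    -- From here on, only the measurability of the preceding state matters.
    generalize (fun p => (acsaLoop H lam (x₀ p) t).output (O p) (s p)) = S at ih h1 h2
    simp only [acsaStep, OracleAlg.output]
    have comb : ∀ {u v : Q → Vec d}, Measurable u → Measurable v → ∀ a b : ℝ,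
        Measurable fun p => a • u p + b • v p := fun hu hv a b => by fun_prop
    have step : ∀ {u v w : Q → Vec d}, Measurable u → Measurable v → Measurable w →
        ∀ a b c : ℝ, Measurable fun p => a • u p + b • v p - c • w p :=
      fun hu hv hw a b c => by fun_prop
    have hmd := comb h2 h1
    have hx := fun a b a' b' c => step (hmd a b) h1
      (hO.comp (measurable_id.prodMk ((hmd a b).prodMk h3))) a' b' c
    exact (hx _ _ _ _ _).prodMk (comb (hx _ _ _ _ _) h2 _ _)

theorem measurable_output_acsa {Q : Type*} [MeasurableSpace Q] {O : Q → Vec d → Z → Info d}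
    (hO : Measurable fun q : Q × Vec d × Z => (O q.1 q.2.1 q.2.2).2) {x₀ : Q → Vec d}
    (hx₀ : Measurable x₀) {s : Q → ℕ → Z} (hs : Measurable s) (H lam : ℝ) (m : ℕ) :
    Measurable fun p => (acsa H lam m (x₀ p)).output (O p) (s p) := by
  simp only [acsa, OracleAlg.output_bind]
  exact (measurable_output_acsaLoop hO hx₀ hs H lam m).snd

theorem measurable_output_acsaSq {Q : Type*} [MeasurableSpace Q] {O : Q → Vec d → Z → Info d}
    (hO : Measurable fun q : Q × Vec d × Z => (O q.1 q.2.1 q.2.2).2) {x₀ : Q → Vec d}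
    (hx₀ : Measurable x₀) {s : Q → ℕ → Z} (hs : Measurable s) (H lam : ℝ) (m : ℕ) :
    Measurable fun p => (acsaSq H lam m (x₀ p)).output (O p) (s p) := by
  simp only [acsaSq, OracleAlg.output_bind, numQueries_acsa]
  exact measurable_output_acsa hO (measurable_output_acsa hO hx₀ hs H lam _)
    (measurable_pi_iff.2 fun i => (measurable_pi_apply (i + m / 2)).comp hs) H lam _

theorem measurable_output_recRegRounds_acsaSq {O : Vec d → Z → Info d}
    (hO : Measurable fun q : Vec d × Z => (O q.1 q.2).2) (H lam : ℝ) (n : ℕ) (x₀ : Vec d) (t : ℕ) :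
    Measurable fun z => (recRegRounds acsaSq H lam n x₀ t).output O z := by
  induction t with
  | zero => exact measurable_const
  | succ t ih =>
    simp only [recRegRounds, OracleAlg.output_bind, OracleAlg.output_mapAnswers,
      numQueries_recRegRounds_acsaSq]
    refine measurable_update'.comp (ih.prodMk (measurable_output_acsaSq
      (O := fun z x w => regularize lam t ((recRegRounds acsaSq H lam n x₀ t).output O z) x (O x w))
      ?_ ((measurable_pi_apply t).comp ih)
      (measurable_pi_iff.2 fun i => measurable_pi_apply _) _ _ n))
    refine (hO.comp measurable_snd).add (Finset.measurable_sum _ fun k _ => ?_)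
    have hk : Measurable fun q : (ℕ → Z) × Vec d × Z =>
        (recRegRounds acsaSq H lam n x₀ t).output O q.1 k :=
      ((measurable_pi_apply k).comp ih).comp measurable_fst
    exact (measurable_snd.fst.sub hk).const_smul (lam * 2 ^ k)

theorem measurable_output_recReg_acsaSq {O : Vec d → Z → Info d}
    (hO : Measurable fun q : Vec d × Z => (O q.1 q.2).2) (H lam : ℝ) (m : ℕ) (x₀ : Vec d) :
    Measurable fun z => (recReg acsaSq H lam m x₀).output O z := by
  simp only [recReg, OracleAlg.output_bind]
  exact (measurable_pi_apply _).comp (measurable_output_recRegRounds_acsaSq hO H lam _ x₀ _)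

end Measurability

/-! ### Functions with quadratic bounds -/

section QuadBounds

variable {E : Type*} [NormedAddCommGroup E] [InnerProductSpace ℝ E]

/-- `G` lies between the paraboloids of curvature `mu` and `H` that have slope `g x` at `x`, for
every `x`. The field `g` is the gradient of `G`; no derivative is mentioned, so that quadratic
regularizers can be added without any calculus. -/
structure QuadBounds (H mu : ℝ) (G : E → ℝ) (g : E → E) : Prop where
  lower : ∀ x y, G x + inner ℝ (g x) (y - x) + mu / 2 * ‖y - x‖ ^ 2 ≤ G y
  upper : ∀ x y, G y ≤ G x + inner ℝ (g x) (y - x) + H / 2 * ‖y - x‖ ^ 2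

namespace QuadBounds

variable {H mu : ℝ} {G : E → ℝ} {g : E → E}

/-- Cocoercivity of the gradient of a smooth convex function. -/
theorem norm_sub_sq_le (h : QuadBounds H mu G g) (hH : 0 < H) (hmu : 0 ≤ mu) (x y : E) :
    ‖g y - g x‖ ^ 2 ≤ 2 * H * (G y - G x - inner ℝ (g x) (y - x)) := by
  -- Compare the lower bound at `x` with the upper bound at `y` at the point reached from `y` by a
  -- gradient step for `G - ⟪g x, ·⟫`, a function that is minimal at `x`.
  set w : E := y - H⁻¹ • (g y - g x) with hw
  have h1 := h.lower x w
  have h2 := h.upper y w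
  have e1 : w - y = -(H⁻¹ • (g y - g x)) := by rw [hw]; abel
  have e2 : w - x = (y - x) - H⁻¹ • (g y - g x) := by rw [hw]; abel
  have h3 : 0 ≤ mu / 2 * ‖w - x‖ ^ 2 := by positivity
  rw [e1, norm_neg, norm_smul, inner_neg_right, real_inner_smul_right, mul_pow, norm_inv,
    Real.norm_eq_abs, abs_of_pos hH] at h2
  rw [e2, inner_sub_right, real_inner_smul_right, ← e2] at h1
  have e3 : ‖g y - g x‖ ^ 2 = inner ℝ (g y) (g y - g x) - inner ℝ (g x) (g y - g x) := by
    rw [← inner_sub_left, real_inner_self_eq_norm_sq]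
  have e4 : H / 2 * (H⁻¹ ^ 2 * ‖g y - g x‖ ^ 2) = H⁻¹ / 2 * ‖g y - g x‖ ^ 2 := by
    field_simp
  have h5 : H⁻¹ / 2 * ‖g y - g x‖ ^ 2 ≤ G y - G x - inner ℝ (g x) (y - x) := by
    have : H⁻¹ * ‖g y - g x‖ ^ 2 =
      H⁻¹ * inner ℝ (g y) (g y - g x) - H⁻¹ * inner ℝ (g x) (g y - g x) := by rw [e3]; ring
    linarith
  calc ‖g y - g x‖ ^ 2 = 2 * H * (H⁻¹ / 2 * ‖g y - g x‖ ^ 2) := by field_simp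
    _ ≤ _ := mul_le_mul_of_nonneg_left h5 (by positivity)

theorem norm_sub_le (h : QuadBounds H mu G g) (hH : 0 < H) (hmu : 0 ≤ mu) (x y : E) :
    ‖g y - g x‖ ≤ H * ‖y - x‖ := by
  refine (sq_le_sq₀ (norm_nonneg _) (by positivity)).1 ?_
  have h1 := h.norm_sub_sq_le hH hmu x y
  have h2 := h.upper x y
  have := mul_le_mul_of_nonneg_left (a := 2 * H) (show G y - G x - inner ℝ (g x) (y - x) ≤
    H / 2 * ‖y - x‖ ^ 2 by linarith) (by positivity)
  rw [mul_pow]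
  nlinarith

theorem grad_eq_zero (h : QuadBounds H mu G g) (hH : 0 < H) {u : E} (hu : ∀ y, G u ≤ G y) :
    g u = 0 := by
  have h1 := h.upper u (u - H⁻¹ • g u)
  have h2 := hu (u - H⁻¹ • g u)
  rw [sub_sub_cancel_left, norm_neg, norm_smul, inner_neg_right, real_inner_smul_right, mul_pow,
    norm_inv, Real.norm_eq_abs, abs_of_pos hH, real_inner_self_eq_norm_sq] at h1
  have e : H / 2 * (H⁻¹ ^ 2 * ‖g u‖ ^ 2) = H⁻¹ / 2 * ‖g u‖ ^ 2 := by field_simp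
  rw [e] at h1
  have h3 : H⁻¹ / 2 * ‖g u‖ ^ 2 ≤ 0 := by linarith
  have h4 : 0 < H⁻¹ / 2 := by positivity
  have h5 : ‖g u‖ ^ 2 ≤ 0 := by
    by_contra hc
    exact absurd h3 (not_le.2 (mul_pos h4 (not_le.1 hc)))
  exact norm_eq_zero.1 (pow_eq_zero_iff two_ne_zero |>.1 (le_antisymm h5 (sq_nonneg _)))

theorem norm_sub_minimizer_sq_le (h : QuadBounds H mu G g) (hH : 0 < H) {u : E}
    (hu : ∀ y, G u ≤ G y) (x : E) : mu / 2 * ‖x - u‖ ^ 2 ≤ G x - G u := by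
  have := h.lower u x
  rw [h.grad_eq_zero hH hu, inner_zero_left] at this
  linarith

theorem exists_minimizer [ProperSpace E] (h : QuadBounds H mu G g) (hG : Continuous G)
    (hmu : 0 < mu) : ∃ u, ∀ y, G u ≤ G y := by
  refine hG.exists_forall_le ?_
  have h1 : Filter.Tendsto (fun x : E => ‖x‖ * (mu / 2 * ‖x‖ - ‖g 0‖) + G 0)
      (Filter.cocompact E) Filter.atTop := by
    have hn := tendsto_norm_cocompact_atTop (E := E)
    refine Filter.tendsto_atTop_add_const_right _ _ (hn.atTop_mul_atTop₀ ?_)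
    simp only [sub_eq_add_neg]
    exact Filter.tendsto_atTop_add_const_right _ _ (hn.const_mul_atTop (by positivity))
  refine Filter.tendsto_atTop_mono (fun x => ?_) h1
  have h2 := h.lower 0 x
  rw [sub_zero] at h2
  have h3 := neg_le_of_abs_le (abs_real_inner_le_norm (g 0) x)
  nlinarith

end QuadBounds

/-! ### One iteration of AC-SA -/

/-- Convexity of the squared norm, with weights `a` and `b` of sum `s`. -/
theorem weighted_norm_sq_le {a b s : ℝ} (ha : 0 ≤ a) (hb : 0 ≤ b) (hs : 0 < s) (hab : a + b = s)
    {p q v : E} (hv : s • v = a • p + b • q) : s * ‖v‖ ^ 2 ≤ a * ‖p‖ ^ 2 + b * ‖q‖ ^ 2 := by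
  have h1 : s ^ 2 * ‖v‖ ^ 2 = ‖a • p + b • q‖ ^ 2 := by
    rw [← hv, norm_smul, mul_pow, Real.norm_eq_abs, sq_abs]
  rw [norm_add_sq_real, norm_smul, norm_smul, mul_pow, mul_pow, Real.norm_eq_abs, Real.norm_eq_abs,
    sq_abs, sq_abs, real_inner_smul_left, real_inner_smul_right] at h1
  have h2 := norm_sub_sq_real p q
  have h3 : 0 ≤ a * b * ‖p - q‖ ^ 2 := by positivity
  rw [h2] at h3
  refine le_of_mul_le_mul_left ?_ hs
  rw [← mul_assoc, ← sq, h1, ← hab]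
  nlinarith

/-- One iteration of AC-SA with noise `ξ` in the gradient. Here `xp` is where the prox step would
lead with gradient `0`; it does not depend on `ξ`, so the term linear in `ξ` has mean zero. -/
theorem acsa_step_le {H mu : ℝ} {G : E → ℝ} {g : E → E} (h : QuadBounds H mu G g) {α γ : ℝ}
    (hα0 : 0 ≤ α) (hα1 : α ≤ 1) (hmu : 0 < mu) (hγ : 0 < γ) (hH : H * α ^ 2 ≤ γ)
    {x xag md xp xn ξ : E} (hmd : md = α • xp + (1 - α) • xag)
    (hxp : (mu + γ) • xp = (α * mu) • md + ((1 - α) * mu + γ) • x)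
    (hxn : xn = xp - (α / (mu + γ)) • (g md + ξ)) (u : E) :
    G (α • xn + (1 - α) • xag) - G u + (mu + γ) / 2 * ‖xn - u‖ ^ 2 ≤
      (1 - α) * (G xag - G u) + ((1 - α) * mu + γ) / 2 * ‖x - u‖ ^ 2
        - α * inner ℝ ξ (xp - u) + α ^ 2 / (2 * mu) * ‖ξ‖ ^ 2 := by
  have hs : 0 < mu + γ := by positivity
  have h1α : 0 ≤ 1 - α := by linarith
  set w : E := xn - xp with hw
  have hwg : α • (g md + ξ) = -((mu + γ) • w) := by
    rw [hw, hxn, sub_sub_cancel_left, smul_neg, neg_neg, smul_smul]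
    congr 1
    field_simp
  -- smoothness at `md`
  have hag : (α • xn + (1 - α) • xag) - md = α • w := by
    rw [hmd, hw, smul_sub]; abel
  have h1 := h.upper md (α • xn + (1 - α) • xag)
  rw [hag, norm_smul, mul_pow, Real.norm_eq_abs, sq_abs, real_inner_smul_right] at h1
  -- strong convexity between `md` and the two comparison points
  have h2 := mul_le_mul_of_nonneg_left (h.lower md xag) h1α
  have h3 := mul_le_mul_of_nonneg_left (h.lower md u) hα0
  have h2' : 0 ≤ (1 - α) * (mu / 2 * ‖xag - md‖ ^ 2) := by positivity
  have e1 : α * inner ℝ (g md) w =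
      α * inner ℝ (g md) (xn - u) + α * inner ℝ (g md) (u - md) +
        (1 - α) * inner ℝ (g md) (xag - md) := by
    have : α • w = α • (xn - u) + α • (u - md) + (1 - α) • (xag - md) := by
      rw [← hag]
      module
    simpa [inner_add_right, real_inner_smul_right] using congrArg (fun v => inner ℝ (g md) v) this
  -- the prox step
  have e2 : α * inner ℝ (g md) (xn - u) = -((mu + γ) * inner ℝ w (xn - u)) -
      α * inner ℝ ξ (xp - u) - α * inner ℝ ξ w := by
    have h0 := congrArg (fun v => inner ℝ v (xn - u)) hwg
    simp only [real_inner_smul_left, inner_add_left, inner_neg_left] at h0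
    have : xn - u = (xp - u) + w := by rw [hw]; abel
    have h5 : inner ℝ ξ (xn - u) = inner ℝ ξ (xp - u) + inner ℝ ξ w := by
      rw [this, inner_add_right]
    rw [h5] at h0
    linarith
  have e3 : ‖xp - u‖ ^ 2 = ‖xn - u‖ ^ 2 - 2 * inner ℝ w (xn - u) + ‖w‖ ^ 2 := by
    have : xp - u = (xn - u) - w := by rw [hw]; abel
    rw [this, norm_sub_sq_real, real_inner_comm]
  have h4 := weighted_norm_sq_le (a := α * mu) (b := (1 - α) * mu + γ) (s := mu + γ)
    (p := md - u) (q := x - u) (v := xp - u) (by positivity) (by positivity) hs (by ring) (by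
      rw [smul_sub, hxp]
      module)
  rw [e3, norm_sub_rev md u] at h4
  -- Young's inequality for the remaining noise term
  have h5 : -(α * inner ℝ ξ w) ≤ α ^ 2 / (2 * mu) * ‖ξ‖ ^ 2 + mu / 2 * ‖w‖ ^ 2 := by
    have h6 := neg_le_of_abs_le (abs_real_inner_le_norm ξ w)
    have h7 := mul_le_mul_of_nonneg_left h6 hα0
    have h8 : 0 ≤ mu / 2 * (‖w‖ - α / mu * ‖ξ‖) ^ 2 := by positivity
    have e8 : mu / 2 * (‖w‖ - α / mu * ‖ξ‖) ^ 2 =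
        mu / 2 * ‖w‖ ^ 2 - α * (‖ξ‖ * ‖w‖) + α ^ 2 / (2 * mu) * ‖ξ‖ ^ 2 := by
      field_simp
      ring
    linarith
  have h9 : 0 ≤ (γ - H * α ^ 2) * ‖w‖ ^ 2 := mul_nonneg (by linarith) (sq_nonneg _)
  nlinarith

end QuadBounds

/-! ### Convergence of AC-SA and AC-SA² -/

/-- The gradient part of the answers of `O` is an unbiased estimate of the field `g`, with variance
at most `σ ^ 2`. -/
structure IsGradientOracle {d : ℕ} {Z : Type*} [MeasurableSpace Z] (g : Vec d → Vec d) (σ : ℝ)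
    (D : Measure Z) (O : Vec d → Z → Info d) : Prop where
  integrable : ∀ x, Integrable (fun z => (O x z).2) D
  mean : ∀ x, ∫ z, (O x z).2 ∂D = g x
  integrable_variance : ∀ x, Integrable (fun z => ‖(O x z).2 - g x‖ ^ 2) D
  variance_le : ∀ x, ∫ z, ‖(O x z).2 - g x‖ ^ 2 ∂D ≤ σ ^ 2

/-- The potential of AC-SA after `t` iterations, in the state `(x_t, x_t^{ag})`, relative to the
point `u`. With `γ_t` the prox parameter of the method, it is `t (t + 1) / 2` times
`G(x_t^{ag}) - G(u) + (mu + γ_t) / 2 * ‖x_t - u‖ ^ 2`; the weight turns `γ_t` into the constant `2 * H`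
and so remains meaningful for `t = 0`. -/
noncomputable def acsaPotential {d : ℕ} (H mu : ℝ) (G : Vec d → ℝ) (u : Vec d) (t : ℕ)
    (s : Vec d × Vec d) : ℝ :=
  (t : ℝ) * (t + 1) / 2 * (G s.2 - G u) +
    ((t : ℝ) * (t + 1) / 2 * mu + 2 * H) / 2 * ‖s.1 - u‖ ^ 2

section ACSA

variable {d : ℕ} {Z : Type*} [MeasurableSpace Z] {D : Measure Z} [IsProbabilityMeasure D]
  {O : Vec d → Z → Info d} {H mu σ : ℝ} {G : Vec d → ℝ} {g : Vec d → Vec d} {u : Vec d}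

/-- One iteration increases the expected potential by at most `σ ^ 2 / mu`. -/
theorem expect_acsaStep_le (h : QuadBounds H mu G g) (hO : IsGradientOracle g σ D O) (hH : 0 < H)
    (hmu : 0 < mu) (hu : ∀ y, G u ≤ G y) (t : ℕ) (s : Vec d × Vec d) :
    (acsaStep H mu (t + 1) s).expect D O (fun s => .ofReal (acsaPotential H mu G u (t + 1) s)) ≤
      .ofReal (acsaPotential H mu G u t s) + .ofReal (σ ^ 2 / mu) := by
  simp only [acsaStep, OracleAlg.expect]
  set k : ℝ := ((t + 1 : ℕ) : ℝ) with hk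
  have hk1 : 1 ≤ k := by rw [hk]; exact_mod_cast Nat.le_add_left 1 t
  have hk0 : 0 < k := by linarith
  set α : ℝ := 2 / (k + 1) with hα
  set γ : ℝ := 4 * H / (k * (k + 1)) with hγ
  set md : Vec d := ((1 - α) * (mu + γ) / (γ + (1 - α ^ 2) * mu)) • s.2 +
      (α * ((1 - α) * mu + γ) / (γ + (1 - α ^ 2) * mu)) • s.1 with hmd
  have hα0 : 0 < α := by positivity
  have hα1 : α ≤ 1 := by rw [hα, div_le_one (by linarith)]; linarith
  have hγ0 : 0 < γ := by positivity
  have hs : 0 < mu + γ := by positivity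
  have hden : 0 < γ + (1 - α ^ 2) * mu := by
    have : 0 ≤ 1 - α ^ 2 := by nlinarith
    positivity
  have hHα : H * α ^ 2 ≤ γ := by
    rw [hα, hγ, div_pow, mul_div_assoc', div_le_div_iff₀ (by positivity) (by positivity)]
    nlinarith [mul_pos hH hk0, mul_pos (mul_pos hH hk0) hk0]
  set xp : Vec d := (α * mu / (mu + γ)) • md + (((1 - α) * mu + γ) / (mu + γ)) • s.1 with hxp
  have hxp' : (mu + γ) • xp = (α * mu) • md + ((1 - α) * mu + γ) • s.1 := by
    rw [hxp, smul_add, smul_smul, smul_smul, mul_div_cancel₀ _ hs.ne', mul_div_cancel₀ _ hs.ne']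
  -- the weights in the definition of `md` are the solution of this equation
  have hmd' : md = α • xp + (1 - α) • s.2 := by
    have hm : (γ + (1 - α ^ 2) * mu) • md =
        ((1 - α) * (mu + γ)) • s.2 + (α * ((1 - α) * mu + γ)) • s.1 := by
      rw [hmd, smul_add, smul_smul, smul_smul, mul_div_cancel₀ _ hden.ne',
        mul_div_cancel₀ _ hden.ne']
    refine smul_right_injective _ hs.ne' ?_
    change (mu + γ) • md = (mu + γ) • (α • xp + (1 - α) • s.2)
    have e : (mu + γ) • (α • xp + (1 - α) • s.2) =
        α • ((mu + γ) • xp) + ((1 - α) * (mu + γ)) • s.2 := by module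
    rw [e, hxp']
    have e2 : (mu + γ) • md = (γ + (1 - α ^ 2) * mu) • md + (α ^ 2 * mu) • md := by module
    rw [e2, hm]
    module
  set W : ℝ := k * (k + 1) / 2 with hW
  have hW0 : 0 < W := by positivity
  set ξ : Z → Vec d := fun z => (O md z).2 - g md with hξ
  -- An integrable majorant of the new potential, whose linear part has mean zero. The potential
  -- itself need not be measurable.
  set Y : Z → ℝ := fun z => acsaPotential H mu G u t s +
    (-(W * α) * inner ℝ (xp - u) (ξ z) + W * (α ^ 2 / (2 * mu)) * ‖ξ z‖ ^ 2) with hY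
  have hle : ∀ z, acsaPotential H mu G u (t + 1)
      (xp - (α / (mu + γ)) • (O md z).2,
        α • (xp - (α / (mu + γ)) • (O md z).2) + (1 - α) • s.2) ≤ Y z := by
    intro z
    have h1 := acsa_step_le h hα0.le hα1 hmu hγ0 hHα hmd' hxp'
      (xn := xp - (α / (mu + γ)) • (O md z).2) (ξ := ξ z) (by rw [hξ, add_sub_cancel]) u
    have h2 := mul_le_mul_of_nonneg_left h1 hW0.le
    have c1 : W * γ = 2 * H := by rw [hW, hγ]; field_simp; ring
    have c2 : W * (1 - α) = (t : ℝ) * (t + 1) / 2 := by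
      have : (t : ℝ) = k - 1 := by rw [hk]; push_cast; ring
      rw [hW, hα, this]; field_simp; ring
    have c3 : ((t + 1 : ℕ) : ℝ) * (((t + 1 : ℕ) : ℝ) + 1) / 2 = W := rfl
    have hi : inner ℝ (ξ z) (xp - u) = inner ℝ (xp - u) (ξ z) := real_inner_comm _ _
    simp only [acsaPotential, hY]
    rw [c3, ← c2, ← c1]
    rw [hi] at h2
    linarith
  have hξi : Integrable ξ D := (hO.integrable md).sub (integrable_const _)
  have hξ0 : ∫ z, ξ z ∂D = 0 := by
    rw [hξ, integral_sub (hO.integrable md) (integrable_const _), hO.mean]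
    simp
  have hi1 : Integrable (fun z => inner ℝ (xp - u) (ξ z)) D := hξi.const_inner _
  have hi2 : Integrable (fun z => ‖ξ z‖ ^ 2) D := hO.integrable_variance md
  have hi3 : Integrable (fun z => -(W * α) * inner ℝ (xp - u) (ξ z) +
      W * (α ^ 2 / (2 * mu)) * ‖ξ z‖ ^ 2) D := (hi1.const_mul _).add (hi2.const_mul _)
  have hYi : Integrable Y D := (integrable_const _).add hi3
  have hΦ0 : ∀ t s, 0 ≤ acsaPotential H mu G u t s := by
    intro t s
    have : 0 ≤ G s.2 - G u := sub_nonneg.2 (hu _)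
    unfold acsaPotential
    positivity
  have hYI : ∫ z, Y z ∂D ≤ acsaPotential H mu G u t s + σ ^ 2 / mu := by
    have e : ∫ z, Y z ∂D = acsaPotential H mu G u t s +
        W * (α ^ 2 / (2 * mu)) * ∫ z, ‖ξ z‖ ^ 2 ∂D := by
      rw [hY, integral_add (integrable_const _) hi3,
        integral_add (hi1.const_mul _) (hi2.const_mul _), integral_const_mul, integral_const_mul,
        integral_inner hξi, hξ0]
      simp
    have hv : ∫ z, ‖ξ z‖ ^ 2 ∂D ≤ σ ^ 2 := hO.variance_le md
    have c4 : W * (α ^ 2 / (2 * mu)) ≤ 1 / mu := by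
      have : W * (α ^ 2 / (2 * mu)) = k / (k + 1) * (1 / mu) := by
        rw [hW, hα]; field_simp
      rw [this]
      refine mul_le_of_le_one_left (by positivity) ?_
      rw [div_le_one (by positivity)]
      linarith
    rw [e]
    have : W * (α ^ 2 / (2 * mu)) * ∫ z, ‖ξ z‖ ^ 2 ∂D ≤ 1 / mu * σ ^ 2 :=
      mul_le_mul c4 hv (integral_nonneg fun z => sq_nonneg _) (by positivity)
    rw [one_div_mul_eq_div] at this
    linarith
  calc _ ≤ ∫⁻ z, .ofReal (Y z) ∂D :=
        lintegral_mono fun z => ENNReal.ofReal_le_ofReal (hle z)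
    _ = .ofReal (∫ z, Y z ∂D) :=
        (ofReal_integral_eq_lintegral_ofReal hYi
          (ae_of_all _ fun z => (hΦ0 _ _).trans (hle z))).symm
    _ ≤ _ := by
        rw [← ENNReal.ofReal_add (hΦ0 _ _) (by positivity)]
        exact ENNReal.ofReal_le_ofReal hYI

theorem expect_acsaLoop_le (h : QuadBounds H mu G g) (hO : IsGradientOracle g σ D O) (hH : 0 < H)
    (hmu : 0 < mu) (hu : ∀ y, G u ≤ G y) (x₀ : Vec d) (t : ℕ) :
    (acsaLoop H mu x₀ t).expect D O (fun s => .ofReal (acsaPotential H mu G u t s)) ≤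
      .ofReal (H * ‖x₀ - u‖ ^ 2 + t * (σ ^ 2 / mu)) := by
  induction t with
  | zero =>
    simp only [acsaLoop, OracleAlg.expect, acsaPotential]
    refine ENNReal.ofReal_le_ofReal (le_of_eq ?_)
    push_cast
    ring
  | succ t ih =>
    rw [acsaLoop, OracleAlg.expect_bind]
    refine (OracleAlg.expect_mono _ fun s => expect_acsaStep_le h hO hH hmu hu t s).trans ?_
    rw [OracleAlg.expect_add_const]
    refine (add_le_add_left ih _).trans ?_
    rw [← ENNReal.ofReal_add (by positivity) (by positivity)]
    refine ENNReal.ofReal_le_ofReal (le_of_eq ?_)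
    push_cast
    ring

/-- AC-SA contracts the squared distance to the minimizer, up to noise. -/
theorem expect_acsa_le (h : QuadBounds H mu G g) (hO : IsGradientOracle g σ D O) (hH : 0 < H)
    (hmu : 0 < mu) (hu : ∀ y, G u ≤ G y) (x₀ : Vec d) {n : ℕ} (hn : 0 < n) :
    (acsa H mu n x₀).expect D O (fun x => .ofReal (‖x - u‖ ^ 2)) ≤
      .ofReal (4 * H / (mu * n ^ 2) * ‖x₀ - u‖ ^ 2 + 4 * σ ^ 2 / (mu ^ 2 * n)) := by
  have hn0 : (0 : ℝ) < n := by exact_mod_cast hn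
  rw [acsa, OracleAlg.expect_bind]
  simp only [OracleAlg.expect]
  refine (OracleAlg.expect_affine_le _ (expect_acsaLoop_le h hO hH hmu hu x₀ n) (by positivity)
    (c := 4 / (mu * n ^ 2)) (by positivity) le_rfl fun s => ?_).trans
    (ENNReal.ofReal_le_ofReal (le_of_eq ?_))
  · have h1 := h.norm_sub_minimizer_sq_le hH hu s.2
    have h0 : 0 ≤ G s.2 - G u := sub_nonneg.2 (hu _)
    have h2 : (n : ℝ) ^ 2 / 2 * (mu / 2 * ‖s.2 - u‖ ^ 2) ≤ acsaPotential H mu G u n s := by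
      have h3 : (n : ℝ) ^ 2 / 2 * (mu / 2 * ‖s.2 - u‖ ^ 2) ≤ (n : ℝ) * (n + 1) / 2 * (G s.2 - G u) :=
        mul_le_mul (by nlinarith) h1 (by positivity) (by positivity)
      have h4 : 0 ≤ ((n : ℝ) * (n + 1) / 2 * mu + 2 * H) / 2 * ‖s.1 - u‖ ^ 2 := by positivity
      unfold acsaPotential
      linarith
    have h5 := mul_le_mul_of_nonneg_left h2 (show 0 ≤ 4 / (mu * (n : ℝ) ^ 2) by positivity)
    have e : 4 / (mu * (n : ℝ) ^ 2) * ((n : ℝ) ^ 2 / 2 * (mu / 2 * ‖s.2 - u‖ ^ 2)) =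
        ‖s.2 - u‖ ^ 2 := by field_simp; ring
    linarith
  · field_simp
    ring

/-- AC-SA² contracts the squared distance with the square of the factor of AC-SA. -/
theorem expect_acsaSq_le (h : QuadBounds H mu G g) (hO : IsGradientOracle g σ D O) (hH : 0 < H)
    (hmu : 0 < mu) (hu : ∀ y, G u ≤ G y) (x₀ : Vec d) {n : ℕ} (hn : 0 < n)
    (hq : 4 * H ≤ mu * n ^ 2) :
    (acsaSq H mu (2 * n) x₀).expect D O (fun x => .ofReal (‖x - u‖ ^ 2)) ≤
      .ofReal ((4 * H / (mu * n ^ 2)) ^ 2 * ‖x₀ - u‖ ^ 2 + 8 * σ ^ 2 / (mu ^ 2 * n)) := by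
  have hn0 : (0 : ℝ) < n := by exact_mod_cast hn
  rw [acsaSq, OracleAlg.expect_bind, Nat.mul_div_cancel_left n two_pos]
  refine (OracleAlg.expect_mono _ fun x => expect_acsa_le h hO hH hmu hu x hn).trans
    ((OracleAlg.expect_affine_le _ (expect_acsa_le h hO hH hmu hu x₀ hn) (by positivity)
      (by positivity) (by positivity) fun x => le_rfl).trans (ENNReal.ofReal_le_ofReal ?_))
  have hq1 : 4 * H / (mu * n ^ 2) ≤ 1 := (div_le_one (by positivity)).2 hq
  have hv : 0 ≤ 4 * σ ^ 2 / (mu ^ 2 * n) := by positivity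
  have := mul_le_mul_of_nonneg_right hq1 hv
  have e : 8 * σ ^ 2 / (mu ^ 2 * n) = 2 * (4 * σ ^ 2 / (mu ^ 2 * n)) := by ring
  rw [e]
  linarith

end ACSA

/-! ### The regularized objectives -/

section Regularized

variable {d : ℕ}

/-- The `t`-th regularized objective for the centers `c 1, …, c t`. -/
noncomputable def regObj (lam : ℝ) (F : Vec d → ℝ) (t : ℕ) (c : ℕ → Vec d) (x : Vec d) : ℝ :=
  F x + lam * ∑ k ∈ Finset.Icc 1 t, 2 ^ (k - 1) * ‖x - c k‖ ^ 2

/-- The gradient of `regObj lam F t c`, when `g` is the gradient of `F`. -/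
noncomputable def regGrad (lam : ℝ) (g : Vec d → Vec d) (t : ℕ) (c : ℕ → Vec d) (x : Vec d) :
    Vec d :=
  g x + ∑ k ∈ Finset.Icc 1 t, (lam * 2 ^ k) • (x - c k)

/-- A minimizer of the `t`-th regularized objective (an arbitrary point if there is none). -/
noncomputable def regMin (lam : ℝ) (F : Vec d → ℝ) (t : ℕ) (c : ℕ → Vec d) : Vec d :=
  Classical.epsilon fun u => ∀ y, regObj lam F t c u ≤ regObj lam F t c y

/-- The distance of the `k`-th iterate to the minimizer that round `k` aims at, weighted by
the curvature of the regularizer that is centered at this iterate afterwards. -/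
noncomputable def roundError (lam : ℝ) (F : Vec d → ℝ) (k : ℕ) (c : ℕ → Vec d) : ℝ :=
  lam * 2 ^ k * ‖c k - regMin lam F (k - 1) c‖

variable {H lam : ℝ} {F : Vec d → ℝ} {g : Vec d → Vec d}

theorem regObj_zero (c : ℕ → Vec d) : regObj lam F 0 c = F := by
  funext x; simp [regObj]

theorem regObj_succ (t : ℕ) (c : ℕ → Vec d) (x : Vec d) :
    regObj lam F (t + 1) c x = regObj lam F t c x + lam * 2 ^ (t + 1) / 2 * ‖x - c (t + 1)‖ ^ 2 := by
  simp only [regObj]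
  rw [Finset.sum_Icc_succ_top (Nat.le_add_left 1 t), Nat.add_sub_cancel, pow_succ]
  ring

theorem regGrad_succ (t : ℕ) (c : ℕ → Vec d) (x : Vec d) :
    regGrad lam g (t + 1) c x = regGrad lam g t c x + (lam * 2 ^ (t + 1)) • (x - c (t + 1)) := by
  simp only [regGrad]
  rw [Finset.sum_Icc_succ_top (Nat.le_add_left 1 t), add_assoc]

theorem regMin_congr {t : ℕ} {c c' : ℕ → Vec d} (h : ∀ k ∈ Finset.Icc 1 t, c k = c' k) :
    regMin lam F t c = regMin lam F t c' := by
  have : regObj lam F t c = regObj lam F t c' := by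
    funext x
    simp only [regObj]
    congr 2
    exact Finset.sum_congr rfl fun k hk => by rw [h k hk]
  simp only [regMin, this]

theorem sum_Icc_two_pow (t : ℕ) : ∑ k ∈ Finset.Icc 1 t, (2 : ℝ) ^ k = 2 ^ (t + 1) - 2 := by
  induction t with
  | zero => simp
  | succ t ih => rw [Finset.sum_Icc_succ_top (Nat.le_add_left 1 t), ih]; ring

theorem QuadBounds.add_sq {E : Type*} [NormedAddCommGroup E] [InnerProductSpace ℝ E] {H mu : ℝ}
    {G : E → ℝ} {g : E → E} (h : QuadBounds H mu G g) (a : ℝ) (c : E) :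
    QuadBounds (H + a) (mu + a) (fun x => G x + a / 2 * ‖x - c‖ ^ 2)
      (fun x => g x + a • (x - c)) := by
  have e : ∀ x y : E, ‖y - c‖ ^ 2 =
      ‖x - c‖ ^ 2 + 2 * inner ℝ (x - c) (y - x) + ‖y - x‖ ^ 2 := fun x y => by
    rw [← norm_add_sq_real]
    congr 2
    abel
  constructor
  · intro x y
    have := h.lower x y
    rw [e x y, inner_add_left, real_inner_smul_left]
    linarith
  · intro x y
    have := h.upper x y
    rw [e x y, inner_add_left, real_inner_smul_left]
    linarith

/-- The regularized objectives have the parameters that the algorithm passes to its subroutine. -/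
theorem QuadBounds.reg (h : QuadBounds H lam F g) (t : ℕ) (c : ℕ → Vec d) :
    QuadBounds (H + lam * ∑ k ∈ Finset.Icc 1 t, 2 ^ k) (lam + lam * ∑ k ∈ Finset.Icc 1 t, 2 ^ k)
      (regObj lam F t c) (regGrad lam g t c) := by
  induction t with
  | zero =>
    have : regGrad lam g 0 c = g := by funext x; simp [regGrad]
    simpa [regObj_zero, this] using h
  | succ t ih =>
    have := ih.add_sq (lam * 2 ^ (t + 1)) (c (t + 1))
    rw [Finset.sum_Icc_succ_top (Nat.le_add_left 1 t), mul_add, ← add_assoc, ← add_assoc]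
    simpa only [← regObj_succ, ← regGrad_succ] using this

theorem regCurvature_pos (hlam : 0 < lam) (t : ℕ) :
    0 < lam + lam * ∑ k ∈ Finset.Icc 1 t, (2 : ℝ) ^ k := by
  have : 0 ≤ ∑ k ∈ Finset.Icc 1 t, (2 : ℝ) ^ k := Finset.sum_nonneg fun k _ => by positivity
  positivity

theorem regMin_le (h : QuadBounds H lam F g) (hF : Continuous F) (hlam : 0 < lam) (t : ℕ)
    (c : ℕ → Vec d) (y : Vec d) : regObj lam F t c (regMin lam F t c) ≤ regObj lam F t c y := by
  have hc : Continuous (regObj lam F t c) := by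
    unfold regObj
    fun_prop
  exact Classical.epsilon_spec ((h.reg t c).exists_minimizer hc (regCurvature_pos hlam t)) y

/-- Adding a regularizer centered at `c (t + 1)` moves the minimizer towards `c (t + 1)`. -/
theorem norm_sub_regMin_succ_le (h : QuadBounds H lam F g) (hF : Continuous F) (hlam : 0 < lam)
    (t : ℕ) (c : ℕ → Vec d) :
    ‖c (t + 1) - regMin lam F (t + 1) c‖ ≤ ‖c (t + 1) - regMin lam F t c‖ := by
  have h1 := regMin_le h hF hlam (t + 1) c (regMin lam F t c)
  have h2 := regMin_le h hF hlam t c (regMin lam F (t + 1) c)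
  rw [regObj_succ, regObj_succ] at h1
  have h3 : lam * 2 ^ (t + 1) / 2 * ‖regMin lam F (t + 1) c - c (t + 1)‖ ^ 2 ≤
      lam * 2 ^ (t + 1) / 2 * ‖regMin lam F t c - c (t + 1)‖ ^ 2 := by linarith
  have h4 := le_of_mul_le_mul_left h3 (by positivity)
  rw [norm_sub_rev, norm_sub_rev (c (t + 1))]
  exact (sq_le_sq₀ (norm_nonneg _) (norm_nonneg _)).1 h4

theorem roundError_nonneg (hlam : 0 < lam) (k : ℕ) (c : ℕ → Vec d) :
    0 ≤ roundError lam F k c := by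
  unfold roundError
  positivity

/-- The gradient of the regularizer at the minimizer of the regularized objective is controlled by
the errors of all rounds. -/
theorem sum_norm_regMin_sub_le (h : QuadBounds H lam F g) (hF : Continuous F) (hlam : 0 < lam)
    (t : ℕ) (c : ℕ → Vec d) :
    ∑ k ∈ Finset.Icc 1 t, lam * 2 ^ k * ‖regMin lam F t c - c k‖ ≤
      3 * ∑ k ∈ Finset.Icc 1 t, roundError lam F k c := by
  induction t with
  | zero => simp
  | succ t ih =>
    rw [Finset.sum_Icc_succ_top (Nat.le_add_left 1 t), Finset.sum_Icc_succ_top (Nat.le_add_left 1 t)]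
    have h1 := norm_sub_regMin_succ_le h hF hlam t c
    set e : ℝ := ‖c (t + 1) - regMin lam F t c‖ with he
    have h2 : ‖regMin lam F (t + 1) c - regMin lam F t c‖ ≤ 2 * e := by
      have h0 := norm_sub_le_norm_sub_add_norm_sub (regMin lam F (t + 1) c) (c (t + 1))
        (regMin lam F t c)
      rw [norm_sub_rev (regMin lam F (t + 1) c) (c (t + 1)), ← he] at h0
      linarith
    have h3 : ∑ k ∈ Finset.Icc 1 t, lam * 2 ^ k * ‖regMin lam F (t + 1) c - c k‖ ≤
        (∑ k ∈ Finset.Icc 1 t, lam * 2 ^ k * ‖regMin lam F t c - c k‖) +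
          (∑ k ∈ Finset.Icc 1 t, (2 : ℝ) ^ k) * (lam * (2 * e)) := by
      rw [Finset.sum_mul, ← Finset.sum_add_distrib]
      refine Finset.sum_le_sum fun k _ => ?_
      have h0 := norm_sub_le_norm_sub_add_norm_sub (regMin lam F (t + 1) c) (regMin lam F t c) (c k)
      have := mul_le_mul_of_nonneg_left (h0.trans (add_le_add_left h2 _))
        (show 0 ≤ lam * 2 ^ k by positivity)
      linarith
    rw [sum_Icc_two_pow] at h3
    have h4 : (2 ^ (t + 1) - 2) * (lam * (2 * e)) ≤ 2 ^ (t + 1) * (lam * (2 * e)) := by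
      have : 0 ≤ lam * (2 * e) := by positivity
      linarith
    have h5 : lam * 2 ^ (t + 1) * ‖regMin lam F (t + 1) c - c (t + 1)‖ ≤ lam * 2 ^ (t + 1) * e := by
      rw [norm_sub_rev]
      exact mul_le_mul_of_nonneg_left h1 (by positivity)
    have h6 : roundError lam F (t + 1) c = lam * 2 ^ (t + 1) * e := by
      simp [roundError, he]
    rw [h6]
    linarith

/-- The gradient at the last iterate is controlled by the errors of all rounds. -/
theorem norm_grad_le (h : QuadBounds H lam F g) (hF : Continuous F) (hlam : 0 < lam) (hH : 0 < H)
    {t : ℕ} (hT : lam * 2 ^ (t + 1) ≤ H) (hT' : H ≤ lam * 2 ^ (t + 2)) (c : ℕ → Vec d) :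
    ‖g (c (t + 1))‖ ≤ 8 * ∑ k ∈ Finset.Icc 1 (t + 1), roundError lam F k c := by
  set u := regMin lam F t c with hu
  set e : ℝ := ‖c (t + 1) - u‖ with he
  have hb : roundError lam F (t + 1) c = lam * 2 ^ (t + 1) * e := by simp [roundError, he, hu]
  have hS0 : 0 ≤ ∑ k ∈ Finset.Icc 1 t, (2 : ℝ) ^ k := Finset.sum_nonneg fun k _ => by positivity
  have hS := sum_Icc_two_pow t
  have hH' : 0 < H + lam * ∑ k ∈ Finset.Icc 1 t, (2 : ℝ) ^ k := by positivity
  have hreg := h.reg t c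
  have h0 : regGrad lam g t c u = 0 := hreg.grad_eq_zero hH' (regMin_le h hF hlam t c)
  have h1 := hreg.norm_sub_le hH' (regCurvature_pos hlam t).le u (c (t + 1))
  rw [h0, sub_zero, ← he] at h1
  have h2 : ‖g (c (t + 1))‖ ≤ ‖regGrad lam g t c (c (t + 1))‖ +
      ∑ k ∈ Finset.Icc 1 t, lam * 2 ^ k * ‖c (t + 1) - c k‖ := by
    have : g (c (t + 1)) = regGrad lam g t c (c (t + 1)) -
        ∑ k ∈ Finset.Icc 1 t, (lam * 2 ^ k) • (c (t + 1) - c k) := by simp [regGrad]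
    rw [this]
    refine (norm_sub_le _ _).trans (add_le_add_right ((norm_sum_le _ _).trans
      (Finset.sum_le_sum fun k _ => ?_)) _)
    rw [norm_smul, Real.norm_eq_abs, abs_of_pos (by positivity)]
  have h3 : ∑ k ∈ Finset.Icc 1 t, lam * 2 ^ k * ‖c (t + 1) - c k‖ ≤
      (∑ k ∈ Finset.Icc 1 t, (2 : ℝ) ^ k) * (lam * e) +
        ∑ k ∈ Finset.Icc 1 t, lam * 2 ^ k * ‖u - c k‖ := by
    rw [Finset.sum_mul, ← Finset.sum_add_distrib]
    refine Finset.sum_le_sum fun k _ => ?_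
    have := mul_le_mul_of_nonneg_left (norm_sub_le_norm_sub_add_norm_sub (c (t + 1)) u (c k))
        (show 0 ≤ lam * 2 ^ k by positivity)
    linarith
  have h4 := sum_norm_regMin_sub_le h hF hlam t c
  rw [← hu] at h4
  have he0 : 0 ≤ e := norm_nonneg _
  rw [hS] at h1 h3
  have h5 : (H + lam * (2 ^ (t + 1) - 2)) * e ≤ 2 * H * e :=
    mul_le_mul_of_nonneg_right (by linarith) he0
  have h6 : H * e ≤ lam * 2 ^ (t + 2) * e := mul_le_mul_of_nonneg_right hT' he0
  have h7 : lam * 2 ^ (t + 2) * e = 2 * (lam * 2 ^ (t + 1) * e) := by ring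
  have h8 : 0 ≤ lam * e := by positivity
  have h8' : 0 ≤ lam * 2 ^ (t + 1) * e := by positivity
  have h9 : 0 ≤ ∑ k ∈ Finset.Icc 1 t, roundError lam F k c :=
    Finset.sum_nonneg fun k _ => roundError_nonneg hlam k c
  rw [Finset.sum_Icc_succ_top (Nat.le_add_left 1 t), hb]
  linarith

end Regularized

/-! ### The rounds of recursive regularization -/

section Rounds

variable {d : ℕ} {Z : Type*} [MeasurableSpace Z] {D : Measure Z} [IsProbabilityMeasure D]
  {O : Vec d → Z → Info d} {H lam σ : ℝ} {F : Vec d → ℝ} {g : Vec d → Vec d}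

/-- Jensen's inequality for the square. It is derived from `2 * r * φ ≤ φ ^ 2 + r ^ 2`, which needs
no measurability of `φ`. -/
theorem OracleAlg.expect_le_of_sq {X I A : Type} {O : X → Z → I} (a : OracleAlg X I A) {φ : A → ℝ}
    {r : ℝ} (hr : 0 < r) (h : a.expect D O (fun x => .ofReal (φ x ^ 2)) ≤ .ofReal (r ^ 2)) :
    a.expect D O (fun x => .ofReal (φ x)) ≤ .ofReal r := by
  refine (a.expect_affine_le h (by positivity) (c := 1 / (2 * r)) (b := r / 2) (by positivity)
    (by positivity) fun x => ?_).trans (ENNReal.ofReal_le_ofReal (le_of_eq ?_))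
  · have h1 : 0 ≤ (φ x - r) ^ 2 / (2 * r) := by positivity
    have e : (φ x - r) ^ 2 / (2 * r) = 1 / (2 * r) * φ x ^ 2 + r / 2 - φ x := by
      field_simp
      ring
    linarith
  · field_simp
    ring

theorem IsGradientOracle.reg (hO : IsGradientOracle g σ D O) (t : ℕ) (c : ℕ → Vec d) :
    IsGradientOracle (regGrad lam g t c) σ D (fun x z => regularize lam t c x (O x z)) := by
  have e : ∀ x z, (regularize lam t c x (O x z)).2 - regGrad lam g t c x = (O x z).2 - g x :=
    fun x z => add_sub_add_right_eq_sub _ _ _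
  refine ⟨fun x => (hO.integrable x).add (integrable_const _), fun x => ?_, fun x => ?_,
    fun x => ?_⟩
  · simp only [regularize, regGrad]
    rw [integral_add (hO.integrable x) (integrable_const _), hO.mean]
    simp
  · simpa only [e] using hO.integrable_variance x
  · simpa only [e] using hO.variance_le x

/-- The error of round `t + 1`, when the distance of its initial point to its target contributes
at most `a` and the noise at most `w`. -/
theorem expect_round_le (h : QuadBounds H lam F g) (hF : Continuous F)
    (hO : IsGradientOracle g σ D O) (hlam : 0 < lam) (hH : 0 < H) {t : ℕ}
    (hT : lam * 2 ^ (t + 1) ≤ H) {n : ℕ} (hn : 0 < n) (hHn : 16 * H ≤ lam * n ^ 2) {a w : ℝ}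
    (hw : 0 < w) (hσ : 32 * σ ^ 2 ≤ w ^ 2 * n) (c : ℕ → Vec d)
    (ha : 16 * H / n ^ 2 * ‖c t - regMin lam F t c‖ ≤ a) :
    ((acsaSq (H + lam * ∑ k ∈ Finset.Icc 1 t, 2 ^ k) (lam + lam * ∑ k ∈ Finset.Icc 1 t, 2 ^ k)
      (2 * n) (c t)).mapAnswers (regularize lam t c)).expect D O
        (fun x => .ofReal (lam * 2 ^ (t + 1) * ‖x - regMin lam F t c‖)) ≤ .ofReal (a + w) := by
  have hn0 : (0 : ℝ) < n := by exact_mod_cast hn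
  rw [OracleAlg.expect_mapAnswers]
  have hS := sum_Icc_two_pow t
  set H' := H + lam * ∑ k ∈ Finset.Icc 1 t, (2 : ℝ) ^ k with hH'
  set mu := lam + lam * ∑ k ∈ Finset.Icc 1 t, (2 : ℝ) ^ k with hmu
  have hmu0 : 0 < mu := regCurvature_pos hlam t
  have hS0 : 0 ≤ ∑ k ∈ Finset.Icc 1 t, (2 : ℝ) ^ k := Finset.sum_nonneg fun k _ => by positivity
  have hH'0 : 0 < H' := by positivity
  have hH'2 : H' ≤ 2 * H := by rw [hH', hS]; linarith
  have h2t : (1 : ℝ) ≤ 2 ^ t := one_le_pow₀ (by norm_num)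
  have hmu2 : lam * 2 ^ t ≤ mu := by
    rw [hmu, hS, pow_succ]
    nlinarith
  have hlmu : lam ≤ mu := by nlinarith
  have hq : 4 * H' ≤ mu * n ^ 2 := by
    have : lam * (n : ℝ) ^ 2 ≤ mu * n ^ 2 := mul_le_mul_of_nonneg_right hlmu (by positivity)
    linarith
  have hmain := expect_acsaSq_le (h.reg t c) (hO.reg t c) hH'0 hmu0 (regMin_le h hF hlam t c) (c t)
    hn hq
  set u := regMin lam F t c with hu
  set L := lam * 2 ^ (t + 1) with hL
  have hL0 : 0 < L := by positivity
  have hLmu : L ≤ 2 * mu := by rw [hL, pow_succ]; linarith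
  have ha0 : 0 ≤ a := le_trans (by positivity) ha
  refine OracleAlg.expect_le_of_sq _ (by positivity) ?_
  refine (OracleAlg.expect_affine_le _ hmain (by positivity) (c := L ^ 2) (by positivity) le_rfl
    fun x => by rw [mul_pow, add_zero]).trans (ENNReal.ofReal_le_ofReal ?_)
  have hbias : L * (4 * H' / (mu * n ^ 2)) * ‖c t - u‖ ≤ a := by
    refine le_trans (mul_le_mul_of_nonneg_right ?_ (norm_nonneg _)) ha
    rw [mul_div_assoc', div_le_div_iff₀ (by positivity) (by positivity)]
    have : L * (4 * H') ≤ 2 * mu * (4 * (2 * H)) :=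
      mul_le_mul hLmu (by linarith) (by positivity) (by positivity)
    have := mul_le_mul_of_nonneg_right this (show 0 ≤ (n : ℝ) ^ 2 by positivity)
    linarith
  have hnoise : L ^ 2 * (8 * σ ^ 2 / (mu ^ 2 * n)) ≤ w ^ 2 := by
    rw [mul_div_assoc', div_le_iff₀ (by positivity)]
    have h1 : L ^ 2 ≤ (2 * mu) ^ 2 := pow_le_pow_left₀ hL0.le hLmu 2
    have h2 := mul_le_mul_of_nonneg_right h1 (show 0 ≤ 8 * σ ^ 2 by positivity)
    have h3 := mul_le_mul_of_nonneg_left hσ (show 0 ≤ mu ^ 2 by positivity)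
    linarith
  have hbias0 : 0 ≤ L * (4 * H' / (mu * n ^ 2)) * ‖c t - u‖ := by positivity
  have h3 := pow_le_pow_left₀ hbias0 hbias 2
  have h4 : 0 ≤ a * w := by positivity
  have e : L ^ 2 * ((4 * H' / (mu * n ^ 2)) ^ 2 * ‖c t - u‖ ^ 2 + 8 * σ ^ 2 / (mu ^ 2 * n)) + 0 =
    (L * (4 * H' / (mu * n ^ 2)) * ‖c t - u‖) ^ 2 + L ^ 2 * (8 * σ ^ 2 / (mu ^ 2 * n)) := by ring
  rw [e]
  nlinarith

/-- The expected sum of the errors of the rounds. The last error is counted twice: each round at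
least halves the error that it inherits, so this pays for its share in the later rounds. -/
theorem expect_recRegRounds_le (h : QuadBounds H lam F g) (hF : Continuous F)
    (hO : IsGradientOracle g σ D O) (hlam : 0 < lam) (hH : 0 < H) {n : ℕ} (hn : 0 < n)
    (hHn : 16 * H ≤ lam * n ^ 2) {a w R : ℝ} (hw : 0 < w) (hσ : 32 * σ ^ 2 ≤ w ^ 2 * n)
    {x₀ xs : Vec d} (hxs : ∀ y, F xs ≤ F y) (hR : ‖x₀ - xs‖ ≤ R) (ha : 16 * H / n ^ 2 * R ≤ a)
    (t : ℕ) (hT : lam * 2 ^ (t + 1) ≤ H) :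
    (recRegRounds acsaSq H lam (2 * n) x₀ (t + 1)).expect D O (fun c => .ofReal
      ((∑ k ∈ Finset.Icc 1 (t + 1), roundError lam F k c) + roundError lam F (t + 1) c)) ≤
      .ofReal (2 * a + 2 * (t + 1) * w) := by
  have hn0 : (0 : ℝ) < n := by exact_mod_cast hn
  have ha0 : 0 ≤ a := by
    have : 0 ≤ R := (norm_nonneg _).trans hR
    exact le_trans (by positivity) ha
  -- the potential after round `t + 1`, in terms of its output `x`
  have hupd : ∀ (t : ℕ) (c : ℕ → Vec d) (x : Vec d),
      (∑ k ∈ Finset.Icc 1 (t + 1), roundError lam F k (Function.update c (t + 1) x)) +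
        roundError lam F (t + 1) (Function.update c (t + 1) x) =
      2 * (lam * 2 ^ (t + 1) * ‖x - regMin lam F t c‖) +
        ∑ k ∈ Finset.Icc 1 t, roundError lam F k c := by
    intro t c x
    have h1 : ∀ s ≤ t, regMin lam F s (Function.update c (t + 1) x) = regMin lam F s c :=
      fun s hs => regMin_congr fun k hk => Function.update_of_ne (by
        have := (Finset.mem_Icc.1 hk).2
        omega) _ _
    have h2 : ∀ k ∈ Finset.Icc 1 t,
        roundError lam F k (Function.update c (t + 1) x) = roundError lam F k c := by
      intro k hk
      have := (Finset.mem_Icc.1 hk).2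
      rw [roundError, roundError, h1 _ (by omega), Function.update_of_ne (by omega)]
    have h3 : roundError lam F (t + 1) (Function.update c (t + 1) x) =
        lam * 2 ^ (t + 1) * ‖x - regMin lam F t c‖ := by
      rw [roundError, Nat.add_sub_cancel, h1 t le_rfl, Function.update_self]
    rw [Finset.sum_Icc_succ_top (Nat.le_add_left 1 t), Finset.sum_congr rfl h2, h3]
    ring
  have hstep : ∀ (t : ℕ) (c : ℕ → Vec d) (b : ℝ), lam * 2 ^ (t + 1) ≤ H →
      16 * H / n ^ 2 * ‖c t - regMin lam F t c‖ ≤ b →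
      ((acsaSq (H + lam * ∑ k ∈ Finset.Icc 1 t, 2 ^ k) (lam + lam * ∑ k ∈ Finset.Icc 1 t, 2 ^ k)
        (2 * n) (c t)).mapAnswers (regularize lam t c)).expect D O (fun x => .ofReal
          ((∑ k ∈ Finset.Icc 1 (t + 1), roundError lam F k (Function.update c (t + 1) x)) +
            roundError lam F (t + 1) (Function.update c (t + 1) x))) ≤
        .ofReal (2 * (b + w) + ∑ k ∈ Finset.Icc 1 t, roundError lam F k c) := by
    intro t c b hT hb
    have hb0 : 0 ≤ b := le_trans (by positivity) hb
    exact OracleAlg.expect_affine_le _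
      (expect_round_le h hF hO hlam hH hT hn hHn hw hσ c hb) (by positivity) zero_le_two
      (Finset.sum_nonneg fun k _ => roundError_nonneg hlam k c) fun x => (hupd t c x).le
  induction t with
  | zero =>
    simp only [recRegRounds, OracleAlg.expect_bind, OracleAlg.expect]
    refine (hstep 0 (fun _ => x₀) a hT ?_).trans (ENNReal.ofReal_le_ofReal (le_of_eq ?_))
    · have hmin := regMin_le h hF hlam 0 fun _ => x₀
      simp only [regObj_zero] at hmin
      have h1 := h.norm_sub_minimizer_sq_le hH hxs (regMin lam F 0 fun _ => x₀)
      have h2 : lam / 2 * ‖regMin lam F 0 (fun _ => x₀) - xs‖ ^ 2 ≤ 0 := h1.trans (by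
        linarith [hmin xs])
      have h3 : ‖regMin lam F 0 (fun _ => x₀) - xs‖ ^ 2 ≤ 0 := by
        by_contra hc
        exact absurd h2 (not_le.2 (mul_pos (by positivity) (not_le.1 hc)))
      have h4 := sub_eq_zero.1 (norm_eq_zero.1
        (pow_eq_zero_iff two_ne_zero |>.1 (le_antisymm h3 (sq_nonneg _))))
      rw [h4]
      exact (mul_le_mul_of_nonneg_left hR (by positivity)).trans ha
    · simp
      ring
  | succ t ih =>
    have hT' : lam * 2 ^ (t + 1) ≤ H := by
      rw [pow_succ, ← mul_assoc] at hT
      have : 0 ≤ lam * 2 ^ (t + 1) := by positivity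
      linarith
    rw [recRegRounds, OracleAlg.expect_bind]
    simp only [OracleAlg.expect_bind, OracleAlg.expect]
    refine (OracleAlg.expect_mono _ fun c => hstep (t + 1) c (roundError lam F (t + 1) c / 2) hT
      ?_).trans ?_
    · have h1 : 16 * H / (n : ℝ) ^ 2 ≤ lam := (div_le_iff₀ (by positivity)).2 hHn
      have h2 := norm_sub_regMin_succ_le h hF hlam t c
      have h3 := mul_le_mul h1 h2 (norm_nonneg _) hlam.le
      have h4 : (1 : ℝ) ≤ 2 ^ t := one_le_pow₀ (by norm_num)
      have h5 : 0 ≤ lam * ‖c (t + 1) - regMin lam F t c‖ := by positivity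
      rw [roundError, Nat.add_sub_cancel, pow_succ (2 : ℝ) t]
      nlinarith
    · refine (OracleAlg.expect_affine_le _ (ih hT') (by positivity) zero_le_one
        (b := 2 * w) (by positivity) fun c => ?_).trans (ENNReal.ofReal_le_ofReal (le_of_eq ?_))
      · linarith
      · push_cast
        ring

end Rounds

/-! ### Stochastic first-order oracles and the whole algorithm -/

theorem IsDomainBounded.quadBounds {d : ℕ} {H lam R : ℝ} {x₀ : Vec d} {F : Vec d → ℝ}
    (h : IsDomainBounded H lam R x₀ F) : QuadBounds H lam F (∇ F) :=
  ⟨h.stronglyConvex.lower, h.smooth.upper⟩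

theorem IsSFO.isGradientOracle {d : ℕ} {Z : Type*} [MeasurableSpace Z] {F : Vec d → ℝ} {σ : ℝ}
    {D : Measure Z} [IsProbabilityMeasure D] {f : Vec d → Z → ℝ} (h : IsSFO F σ D f) :
    IsGradientOracle (∇ F) σ D (sfo f) := by
  refine ⟨fun x => ?_, h.mean_gradient, h.integrable_variance, h.variance_le⟩
  have hm : Measurable (fun z => ∇ (fun y => f y z) x) :=
    h.measurable_gradient.comp (measurable_const.prodMk measurable_id)
  have h1 : MemLp (fun z => ∇ (fun y => f y z) x - ∇ F x) 2 D :=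
    (memLp_two_iff_integrable_sq_norm (hm.sub_const _).aestronglyMeasurable).2
      (h.integrable_variance x)
  have h2 : Integrable (fun z => (∇ (fun y => f y z) x - ∇ F x) + ∇ F x) D :=
    (h1.integrable (by norm_num)).add (integrable_const _)
  simp only [sub_add_cancel] at h2
  exact h2

theorem measurable_gradient {d : ℕ} (F : Vec d → ℝ) : Measurable (∇ F) :=
  (InnerProductSpace.toDual ℝ (Vec d)).symm.continuous.measurable.comp (measurable_fderiv ℝ F)

/-- `expect` is the expectation over any independent sequence of `D`-samples. -/
theorem OracleAlg.lintegral_output_of_iIndepFun {X I A : Type} {Z Ω : Type*} [MeasurableSpace Z]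
    [MeasurableSpace Ω] {D : Measure Z} [IsProbabilityMeasure D] {P : Measure Ω}
    [IsProbabilityMeasure P] {O : X → Z → I} [MeasurableSpace A] {φ : A → ℝ≥0∞}
    (hφ : Measurable φ) (a : OracleAlg X I A) (ha : Measurable fun z => a.output O z)
    {z : ℕ → Ω → Z} (hz : ∀ i, Measurable (z i)) (hD : ∀ i, P.map (z i) = D)
    (hi : iIndepFun z P) :
    ∫⁻ ω, φ (a.output O fun i => z i ω) ∂P = a.expect D O φ := by
  have h1 := (iIndepFun_iff_map_fun_eq_infinitePi_map hz).1 hi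
  simp only [hD] at h1
  rw [← lintegral_output hφ a ha, ← h1]
  exact (lintegral_map (hφ.comp ha) (measurable_pi_iff.2 hz)).symm

/-- The expected gradient norm at the output of recursive regularization, for `2 * n` accesses in
each round. -/
theorem expect_recReg_acsaSq_le {d : ℕ} {Z : Type*} [MeasurableSpace Z] {D : Measure Z}
    [IsProbabilityMeasure D] {O : Vec d → Z → Info d} {H lam σ R ε : ℝ} {F : Vec d → ℝ}
    {g : Vec d → Vec d} (h : QuadBounds H lam F g) (hF : Continuous F)
    (hO : IsGradientOracle g σ D O) (hlam : 0 < lam) (hH : 0 < H) (hε : 0 < ε) {n T : ℕ}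
    (hn : 0 < n) (hT : numRounds H lam = T) (hT0 : 0 < T) (hT1 : lam * 2 ^ T ≤ H)
    (hT2 : H ≤ lam * 2 ^ (T + 1)) (hHn : 16 * H ≤ lam * n ^ 2) (hRn : 512 * H * R ≤ ε * n ^ 2)
    (hσn : 32768 * T ^ 2 * σ ^ 2 ≤ ε ^ 2 * n) {x₀ xs : Vec d} (hxs : ∀ y, F xs ≤ F y)
    (hR : ‖x₀ - xs‖ ≤ R) :
    (recReg acsaSq H lam (T * (2 * n)) x₀).expect D O (fun x => .ofReal ‖g x‖) ≤ .ofReal ε := by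
  have hn0 : (0 : ℝ) < n := by exact_mod_cast hn
  have hT0' : (0 : ℝ) < T := by exact_mod_cast hT0
  rw [recReg, hT, Nat.mul_div_cancel_left _ hT0, OracleAlg.expect_bind]
  simp only [OracleAlg.expect]
  have ha : 16 * H / n ^ 2 * R ≤ ε / 32 := by
    rw [div_mul_eq_mul_div, div_le_div_iff₀ (by positivity) (by norm_num)]
    linarith
  have hσ' : 32 * σ ^ 2 ≤ (ε / (32 * T)) ^ 2 * n := by
    rw [div_pow, div_mul_eq_mul_div, le_div_iff₀ (by positivity)]
    linarith
  obtain ⟨t, rfl⟩ : ∃ t, T = t + 1 := ⟨T - 1, by omega⟩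
  have hsum := expect_recRegRounds_le h hF hO hlam hH hn hHn (w := ε / (32 * (t + 1 : ℕ)))
    (by positivity) hσ' hxs hR ha t hT1
  have hε0 : 0 ≤ 2 * (ε / 32) + 2 * ((t : ℝ) + 1) * (ε / (32 * (t + 1 : ℕ))) := by positivity
  refine (OracleAlg.expect_affine_le _ hsum hε0 (c := 8) (by norm_num) le_rfl
    fun c => ?_).trans (ENNReal.ofReal_le_ofReal (le_of_eq ?_))
  · have h1 := norm_grad_le h hF hlam hH hT1 hT2 c
    have h2 := roundError_nonneg hlam (F := F) (t + 1) c
    linarith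
  · push_cast
    field_simp
    ring

/-! ### The number of accesses -/

theorem numRounds_spec {H lam : ℝ} (hlam : 0 < lam) (hH : 2 * lam ≤ H) :
    0 < numRounds H lam ∧ lam * 2 ^ numRounds H lam ≤ H ∧ H ≤ lam * 2 ^ (numRounds H lam + 1) ∧
      (numRounds H lam : ℝ) ≤ 2 * Real.log (H / lam) := by
  have h2 : 2 ≤ H / lam := (le_div_iff₀ hlam).2 hH
  have hpos : 0 < H / lam := by linarith
  have hlog : 0 ≤ Real.log (H / lam) := Real.log_nonneg (by linarith)
  have hL1 : 1 ≤ Real.logb 2 (H / lam) :=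
    (Real.le_logb_iff_rpow_le one_lt_two hpos).2 (by simpa using h2)
  have hfl := Nat.floor_le (zero_le_one.trans hL1)
  refine ⟨Nat.floor_pos.2 hL1, ?_, ?_, hfl.trans ?_⟩
  · have := (Real.le_logb_iff_rpow_le one_lt_two hpos).1 hfl
    rw [Real.rpow_natCast, le_div_iff₀ hlam] at this
    rw [mul_comm]
    exact this
  · have := (Real.logb_lt_iff_lt_rpow one_lt_two hpos).1 (Nat.lt_floor_add_one _)
    rw [← Nat.cast_succ, Real.rpow_natCast, div_lt_iff₀ hlam] at this
    rw [mul_comm]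
    exact this.le
  · rw [Real.logb, div_le_iff₀ (Real.log_pos (by norm_num))]
    have := Real.log_two_gt_d9
    nlinarith

end StochOpt

open StochOpt in
theorem mainTheorem6 :
    ∃ C : ℝ, 0 < C ∧
      ∀ H lam R σ ε : ℝ, 0 < lam → 2 * lam ≤ H → 0 ≤ R → 0 ≤ σ → 0 < ε →
        ∃ m : ℕ,
          (m : ℝ) ≤ C *
            (√(H / lam) * Real.log (H / lam)
              + √(H * R / ε) * Real.log (H / lam)
              + (√H * σ / (√lam * ε)) ^ (2 / 3 : ℝ) * Real.log (H / lam)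
              + σ ^ 2 / ε ^ 2 * Real.log (H / lam) ^ 3) ∧
          ∀ (d : ℕ) (x₀ : StochOpt.Vec d) (F : StochOpt.Vec d → ℝ),
            StochOpt.IsDomainBounded H lam R x₀ F →
          ∀ (Z : Type*) [MeasurableSpace Z] (D : Measure Z) [IsProbabilityMeasure D]
            (f : StochOpt.Vec d → Z → ℝ), StochOpt.IsSFO F σ D f →
            (∀ z : ℕ → Z,
              (StochOpt.recReg StochOpt.acsaSq H lam m x₀).numQueries (StochOpt.sfo f) z ≤ m) ∧
            ∀ (Ω : Type*) [MeasurableSpace Ω] (P : Measure Ω) [IsProbabilityMeasure P]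
              (z : ℕ → Ω → Z), (∀ i, Measurable (z i)) → (∀ i, P.map (z i) = D) →
              iIndepFun z P →
              Integrable (fun ω => ‖∇ F ((StochOpt.recReg StochOpt.acsaSq H lam m x₀).output
                (StochOpt.sfo f) (fun i => z i ω))‖) P ∧
              ∫ ω, ‖∇ F ((StochOpt.recReg StochOpt.acsaSq H lam m x₀).output
                (StochOpt.sfo f) (fun i => z i ω))‖ ∂P ≤ ε := by
  refine ⟨1000000, by norm_num, fun H lam R σ ε hlam hH hR hσ hε => ?_⟩
  have hH0 : 0 < H := by linarith
  obtain ⟨hT0, hT1, hT2, hTlog⟩ := numRounds_spec hlam hH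
  set T := numRounds H lam with hT
  set ℓ := Real.log (H / lam) with hℓ
  have hT0' : (0 : ℝ) < T := by exact_mod_cast hT0
  set A := √(H / lam) with hA
  set B := √(H * R / ε) with hB
  have hA1 : 1 ≤ A := Real.one_le_sqrt.2 ((one_le_div hlam).2 (by linarith))
  have hB0 : 0 ≤ B := Real.sqrt_nonneg _
  have hA2 : lam * A ^ 2 = H := by
    rw [hA, Real.sq_sqrt (by positivity)]
    field_simp
  have hB2 : ε * B ^ 2 = H * R := by
    rw [hB, Real.sq_sqrt (by positivity)]
    field_simp
  set S := σ ^ 2 / ε ^ 2 with hS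
  have hS0 : 0 ≤ S := by positivity
  -- The three summands enforce, in this order, that each round after the first halves the error,
  -- that the first round forgets the initial distance, and that the noise is small. The first
  -- one also makes AC-SA a contraction, so that AC-SA² passes the noise of its first run on without
  -- amplification; this noise is what the term with exponent `2 / 3` would account for.
  set K := 4 * A + 23 * B + 32768 * T ^ 2 * S with hK
  have hK0 : 0 < K := by positivity
  set n := ⌈K⌉₊ with hn
  have hnK : K ≤ n := Nat.le_ceil K
  have hn0 : 0 < n := Nat.ceil_pos.2 hK0
  have hnS : 0 ≤ 32768 * (T : ℝ) ^ 2 * S := by positivity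
  have hHn : 16 * H ≤ lam * n ^ 2 := by
    have h1 : (4 * A) ^ 2 ≤ (n : ℝ) ^ 2 := pow_le_pow_left₀ (by positivity) (by linarith) 2
    have h2 := mul_le_mul_of_nonneg_left h1 hlam.le
    linarith
  have hRn : 512 * H * R ≤ ε * n ^ 2 := by
    have h1 : (23 * B) ^ 2 ≤ (n : ℝ) ^ 2 := pow_le_pow_left₀ (by positivity) (by linarith) 2
    have h2 := mul_le_mul_of_nonneg_left h1 hε.le
    have h3 : 0 ≤ H * R := by positivity
    linarith
  have hσn : 32768 * T ^ 2 * σ ^ 2 ≤ ε ^ 2 * n := by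
    have h1 := mul_le_mul_of_nonneg_left (show 32768 * (T : ℝ) ^ 2 * S ≤ n by linarith)
      (sq_nonneg ε)
    have h2 : ε ^ 2 * (32768 * (T : ℝ) ^ 2 * S) = 32768 * T ^ 2 * σ ^ 2 := by
      rw [hS]
      field_simp
    linarith
  refine ⟨T * (2 * n), ?_, fun d x₀ F hF Z _ D _ f hf =>
    ⟨fun z => numQueries_recReg_acsaSq_le _ H lam _ x₀ z, fun Ω _ P _ z hz hD hi => ?_⟩⟩
  · have h1 : (n : ℝ) ≤ 5 * A + 23 * B + 32768 * T ^ 2 * S := by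
      have := (Nat.ceil_lt_add_one hK0.le).le
      linarith
    have hℓ0 : 0 ≤ ℓ := by linarith
    have hT2' : (T : ℝ) ^ 2 ≤ (2 * ℓ) ^ 2 := pow_le_pow_left₀ hT0'.le hTlog 2
    have h2 : (n : ℝ) ≤ 5 * A + 23 * B + 32768 * (2 * ℓ) ^ 2 * S := by
      have := mul_le_mul_of_nonneg_right hT2' hS0
      linarith
    have h3 : (T : ℝ) * (2 * n) ≤ 2 * ℓ * (2 * (5 * A + 23 * B + 32768 * (2 * ℓ) ^ 2 * S)) :=
      mul_le_mul hTlog (by linarith) (by positivity) (by positivity)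
    have h4 : 0 ≤ (√H * σ / (√lam * ε)) ^ (2 / 3 : ℝ) * ℓ := by positivity
    have h5 : 0 ≤ A * ℓ := by positivity
    have h6 : 0 ≤ B * ℓ := by positivity
    have h7 : 0 ≤ S * ℓ ^ 3 := by positivity
    push_cast
    nlinarith
  · obtain ⟨xs, hxs, hxR⟩ := hF.exists_minimizer
    have hbound := expect_recReg_acsaSq_le hF.quadBounds hF.smooth.differentiable.continuous
      hf.isGradientOracle hlam hH0 hε hn0 rfl hT0 hT1 hT2 hHn hRn hσn hxs hxR
    have hout := measurable_output_recReg_acsaSq (O := sfo f) hf.measurable_gradient H lam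
      (T * (2 * n)) x₀
    have hg := (measurable_gradient F).norm
    rw [← OracleAlg.lintegral_output_of_iIndepFun hg.ennreal_ofReal _ hout hz hD hi] at hbound
    have hm : Measurable fun ω => ‖∇ F ((recReg acsaSq H lam (T * (2 * n)) x₀).output
        (sfo f) fun i => z i ω)‖ := hg.comp (hout.comp (measurable_pi_iff.2 hz))
    have hint : Integrable (fun ω => ‖∇ F ((recReg acsaSq H lam (T * (2 * n)) x₀).output
        (sfo f) fun i => z i ω)‖) P := by
      refine ⟨hm.aestronglyMeasurable, ?_⟩
      rw [hasFiniteIntegral_iff_ofReal (ae_of_all _ fun ω => norm_nonneg _)]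
      exact hbound.trans_lt ENNReal.ofReal_lt_top
    refine ⟨hint, ?_⟩
    rwa [← ofReal_integral_eq_lintegral_ofReal hint (ae_of_all _ fun ω => norm_nonneg _),
      ENNReal.ofReal_le_ofReal_iff hε.le] at hbound
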